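/- For positive integers $m,n$ and $s\ge 0$, let $a(m,n;s)$ be the number of tilings of the $m\times n$ rectangle by monomers (unit cells) and dimers (pairs of cells sharing a side) with exactly $s$ dimers. Let $$\Theta_{m,n}(z)=\sum_{s=0}^{\lfloor mn/2\rfloor}a(m,n;s)\,z^s$$ be the grand-canonical partition function, let $$\Theta(z)=\lim_{m,n\to\infty}\Theta_{m,n}(z)^{1/(mn)}$$ be its thermodynamic limit, and for $M\ge 1$ let $S_M(z)=\sum_{m+n=M}\ln\Theta_{m,n}(z)$, the sum running over pairs of positive integers (so $S_1=0$). Then there is $r>0$ such that, for every real $z>-r$, all the numbers $\Theta_{m,n}(z)$ are positive, the limit $\Theta(z)$ exists and is positive, and $\ln\Theta(z)=\lim_{m,n\to\infty}\frac{\ln\Theta_{m,n}(z)}{mn}$. The function $\ln\Theta$ is real-analytic at $z=0$. For every integer $N\ge 4$, $$\ln\Theta(z)-\bigl(S_N(z)-3S_{N-1}(z)+3S_{N-2}(z)-S_{N-3}(z)\bigr)=O(z^{N-1})\qquad (z\to 0),$$ where the implied constant may depend on $N$. Hence the third finite difference of the sums $S_M$ agrees with the power series of $\ln\Theta(z)$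 at $0$ up to and including the term of order $z^{N-2}$. -/

import Mathlib

open Filter Topology Asymptotics

namespace MonomerDimer

/-- The cells of the `m × n` rectangle; a unit cell is named by its lower-left corner. -/
def rect (m n : ℕ) : Finset (ℕ × ℕ) := Finset.range m ×ˢ Finset.range n

/-- A dimer is a set of two cells that share a side. -/
def IsDimer (d : Finset (ℕ × ℕ)) : Prop :=
  ∃ p ∈ d, d = {p, (p.1 + 1, p.2)} ∨ d = {p, (p.1, p.2 + 1)}

instance : DecidablePred IsDimer := fun d => by
  unfold IsDimer; infer_instance

/-- The set of all dimers contained in the `m × n` rectangle. -/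
def dimers (m n : ℕ) : Finset (Finset (ℕ × ℕ)) := (rect m n).powerset.filter IsDimer

/-- Tilings of the `m × n` rectangle by monomers and exactly `s` dimers. A tiling is given by the
set of its dimers, which must not overlap; every cell they leave uncovered is a monomer. -/
def tilings (m n s : ℕ) : Finset (Finset (Finset (ℕ × ℕ))) :=
  ((dimers m n).powersetCard s).filter fun T => ∀ d ∈ T, ∀ e ∈ T, d ≠ e → Disjoint d e

/-- The grand-canonical partition function `Θ_{m,n}(z)` of the `m × n` rectangle. -/
noncomputable def partitionFn (m n : ℕ) (z : ℝ) : ℝ :=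
  ∑ s ∈ Finset.range (m * n / 2 + 1), ((tilings m n s).card : ℝ) * z ^ s

/-- The thermodynamic limit `Θ(z)`, the limit of `Θ_{m,n}(z) ^ (1 / (m n))` as `m, n → ∞`. -/
noncomputable def thermoLimit (z : ℝ) : ℝ :=
  limUnder (atTop ×ˢ atTop : Filter (ℕ × ℕ)) fun p =>
    partitionFn p.1 p.2 z ^ (1 / ((p.1 : ℝ) * (p.2 : ℝ)))

/-- `S_M(z)`: the sum of `ln Θ_{m,n}(z)` over all pairs of positive integers with `m + n = M`. -/
noncomputable def logSum (M : ℕ) (z : ℝ) : ℝ :=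
  ∑ p ∈ (Finset.HasAntidiagonal.antidiagonal M).filter (fun p => 0 < p.1 ∧ 0 < p.2),
    Real.log (partitionFn p.1 p.2 z)

end MonomerDimer

/-! Put f(m,n) = ln Θ_{m,n} and let W(i,j) be the second difference of f in both directions
(`mixedDiff`), the net contribution of an (i+1) × (j+1) box. Since f vanishes on degenerate
rectangles, f(m,n) is the sum of (m-i)(n-j) W(i,j) over i < m, j < n, the coefficient counting
translates of the box (`eq_sum_mixedDiff`). If ΣW converges absolutely, division by mn gives ln Θ =
ΣW, while the third difference of S_M is exactly the part of this sum with i + j ≤ N - 2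
(`logSum_thirdDiff`). Everything near 0 thus rests on W(i,j) = O(z^(i+j)), with enough uniformity to
sum.

The order of vanishing is combinatorial. The exponential of W(i,j) is a quotient of products of box
partition functions. Give each dimer its own variable: if fewer than i + j variables are nonzero,
one of the i + j inner grid lines is uncrossed, the boxes factor along it, and numerator and
denominator coincide (`evenProd_eq_oddProd_of_card_lt`). Hence each monomial of their difference
involves at least i + j dimers.

The uniformity is analytic. A deletion induction (`packingSum_ratio`) shows that no partition
function vanishes on a fixed disc, so holomorphic logarithms exist there, bounded linearly in the
area. The Schwarz lemma then turns the order of vanishing into geometric decay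
(`norm_mixedDiff_le`). For nonnegative z, however large, the limit comes from superadditivity
instead. -/

namespace MonomerDimer

/-! ### Algebra of packing sums -/

section HardCore

variable {V : Type*} [DecidableEq V] {R : Type*} [CommSemiring R]

/-- The weighted sum over all subfamilies of `D` with pairwise disjoint members. -/
def packingSum (D : Finset (Finset V)) (x : Finset V → R) : R :=
  ∑ T ∈ D.powerset.filter (fun T => ∀ d ∈ T, ∀ e ∈ T, d ≠ e → Disjoint d e), ∏ e ∈ T, x e

@[simp]
theorem packingSum_empty (x : Finset V → R) : packingSum ∅ x = 1 := by
  simp [packingSum, Finset.filter_singleton]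

/-- Packings either omit `e` or contain it, and in the second case the other members avoid `e`. This
deletion recursion drives all later inductions on the family. -/
theorem packingSum_insert {D : Finset (Finset V)} {e : Finset V} (he : e ∉ D)
    (x : Finset V → R) :
    packingSum (insert e D) x
      = packingSum D x + x e * packingSum (D.filter (Disjoint e)) x := by
  classical
  unfold packingSum
  rw [Finset.powerset_insert, Finset.filter_union, Finset.sum_union]
  · congr 1
    rw [Finset.mul_sum]
    symm
    refine Finset.sum_bij (fun T _ => insert e T) ?_ ?_ ?_ ?_
    · intro T hT
      simp only [Finset.mem_filter, Finset.mem_powerset, Finset.subset_iff] at hT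
      simp only [Finset.mem_filter, Finset.mem_image, Finset.mem_powerset]
      refine ⟨⟨T, fun d hd => (hT.1 hd).1, rfl⟩, ?_⟩
      intro d hd f hf hdf
      rw [Finset.mem_insert] at hd hf
      rcases hd with rfl | hd <;> rcases hf with rfl | hf
      · exact absurd rfl hdf
      · exact (hT.1 hf).2
      · exact (hT.1 hd).2.symm
      · exact hT.2 d hd f hf hdf
    · intro T hT T' hT' h
      simp only [Finset.mem_filter, Finset.mem_powerset, Finset.subset_iff] at hT hT'
      have h1 : e ∉ T := fun h => he (hT.1 h).1
      have h2 : e ∉ T' := fun h => he (hT'.1 h).1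
      rw [← Finset.erase_insert h1, ← Finset.erase_insert h2, h]
    · intro T hT
      simp only [Finset.mem_filter, Finset.mem_image, Finset.mem_powerset] at hT
      obtain ⟨⟨T, hTD, rfl⟩, hT⟩ := hT
      refine ⟨T, ?_, rfl⟩
      simp only [Finset.mem_filter, Finset.mem_powerset, Finset.subset_iff]
      refine ⟨fun d hd => ⟨hTD hd, ?_⟩, fun d hd f hf => hT d (Finset.mem_insert_of_mem hd) f
        (Finset.mem_insert_of_mem hf)⟩
      refine hT e (Finset.mem_insert_self _ _) d (Finset.mem_insert_of_mem hd) ?_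
      rintro rfl
      exact he (hTD hd)
    · intro T hT
      simp only [Finset.mem_filter, Finset.mem_powerset, Finset.subset_iff] at hT
      rw [Finset.prod_insert (fun h => he (hT.1 h).1)]
  · refine Finset.disjoint_filter_filter ?_
    rw [Finset.disjoint_left]
    intro T hT hT'
    simp only [Finset.mem_image, Finset.mem_powerset] at hT hT'
    obtain ⟨T', -, rfl⟩ := hT'
    exact he (hT (Finset.mem_insert_self _ _))

theorem map_packingSum {S F : Type*} [CommSemiring S] [FunLike F R S] [RingHomClass F R S] (φ : F)
    (D : Finset (Finset V)) (x : Finset V → R) :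
    φ (packingSum D x) = packingSum D (fun e => φ (x e)) := by
  simp [packingSum, map_sum, map_prod]

/-- A packing using a member outside `B` has a zero factor. Killing variables is therefore the same
as restricting the family, which links polynomial coefficients to geometry. -/
theorem packingSum_ite (D B : Finset (Finset V)) (x : Finset V → R) :
    packingSum D (fun e => if e ∈ B then x e else 0) = packingSum (D ∩ B) x := by
  unfold packingSum
  symm
  have : ∀ T ∈ (D ∩ B).powerset.filter (fun T => ∀ d ∈ T, ∀ e ∈ T, d ≠ e → Disjoint d e),
      ∏ e ∈ T, x e = ∏ e ∈ T, (if e ∈ B then x e else 0) := by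
    intro T hT
    simp only [Finset.mem_filter, Finset.mem_powerset, Finset.subset_inter_iff] at hT
    exact Finset.prod_congr rfl fun e he => by rw [if_pos (hT.1.2 he)]
  rw [Finset.sum_congr rfl this]
  refine Finset.sum_subset ?_ ?_
  · refine Finset.filter_subset_filter _ (Finset.powerset_mono.2 Finset.inter_subset_left)
  · intro T hT hT'
    simp only [Finset.mem_filter, Finset.mem_powerset, Finset.subset_inter_iff] at hT hT'
    have : ¬ T ⊆ B := fun h => hT' ⟨⟨hT.1, h⟩, hT.2⟩
    obtain ⟨e, he, heB⟩ := Finset.not_subset.1 this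
    exact Finset.prod_eq_zero he (if_neg heB)

theorem packingSum_union {A B : Finset (Finset V)} (hAB : Disjoint A B)
    (h : ∀ d ∈ A, ∀ e ∈ B, Disjoint d e) (x : Finset V → R) :
    packingSum (A ∪ B) x = packingSum A x * packingSum B x := by
  induction A using Finset.strongInduction with
  | H A ih =>
    rcases A.eq_empty_or_nonempty with rfl | ⟨e, he⟩
    · simp
    · obtain ⟨A', heA', rfl⟩ : ∃ A', e ∉ A' ∧ insert e A' = A :=
        ⟨A.erase e, Finset.notMem_erase _ _, Finset.insert_erase he⟩
      have hss : A' ⊂ insert e A' := Finset.ssubset_insert heA'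
      have hfs : A'.filter (Disjoint e) ⊂ insert e A' :=
        (Finset.filter_subset _ _).trans_ssubset hss
      have heB : e ∉ B := Finset.disjoint_left.1 hAB he
      have hB : B.filter (Disjoint e) = B := Finset.filter_true_of_mem fun f hf => h e he f hf
      rw [Finset.insert_union, packingSum_insert (by simp [heA', heB]), Finset.filter_union, hB,
        packingSum_insert heA',
        ih A' hss (hAB.mono_left hss.1) (fun d hd => h d (hss.1 hd)),
        ih _ hfs (hAB.mono_left hfs.1) (fun d hd => h d (hfs.1 hd))]
      ring

theorem packingSum_image {f : V → V} (hf : Function.Injective f) (D : Finset (Finset V))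
    (x : R) :
    packingSum (D.image (Finset.image f)) (fun _ => x) = packingSum D (fun _ => x) := by
  induction D using Finset.strongInduction with
  | H A ih =>
    rcases A.eq_empty_or_nonempty with rfl | ⟨e, he⟩
    · simp
    · obtain ⟨A', heA', rfl⟩ : ∃ A', e ∉ A' ∧ insert e A' = A :=
        ⟨A.erase e, Finset.notMem_erase _ _, Finset.insert_erase he⟩
      have hss : A' ⊂ insert e A' := Finset.ssubset_insert heA'
      have hfs : A'.filter (Disjoint e) ⊂ insert e A' :=
        (Finset.filter_subset _ _).trans_ssubset hss
      have hfi := Finset.image_injective hf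
      rw [Finset.image_insert, packingSum_insert (by simpa [hfi.eq_iff] using heA'),
        packingSum_insert heA', ih A' hss, ← ih _ hfs, Finset.filter_image]
      simp only [Finset.disjoint_image hf]

end HardCore

section Real

variable {V : Type*} [DecidableEq V]

theorem packingSum_mono {A B : Finset (Finset V)} (h : A ⊆ B) {z : ℝ} (hz : 0 ≤ z) :
    packingSum A (fun _ => z) ≤ packingSum B (fun _ => z) := by
  refine Finset.sum_le_sum_of_subset_of_nonneg
    (Finset.filter_subset_filter _ (Finset.powerset_mono.2 h)) fun T _ _ => ?_
  exact Finset.prod_nonneg fun _ _ => hz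

theorem one_le_packingSum (D : Finset (Finset V)) {z : ℝ} (hz : 0 ≤ z) :
    1 ≤ packingSum D (fun _ => z) := by
  simpa using packingSum_mono (Finset.empty_subset D) hz

theorem packingSum_le (D : Finset (Finset V)) {z : ℝ} (hz : 0 ≤ z) :
    packingSum D (fun _ => z) ≤ (1 + z) ^ D.card := by
  induction D using Finset.induction_on with
  | empty => simp
  | insert e D he ih =>
    rw [packingSum_insert he, Finset.card_insert_of_notMem he, pow_succ]
    have h1 : packingSum (D.filter (Disjoint e)) (fun _ => z) ≤ packingSum D (fun _ => z) :=
      packingSum_mono (Finset.filter_subset _ _) hz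
    nlinarith [mul_le_mul_of_nonneg_left h1 hz]

end Real

/-! ### Zero-freeness and holomorphic logarithms at small activity -/

section Ratio

variable {V : Type*} [DecidableEq V] {𝕜 : Type*} [NormedField 𝕜]

/-- If every member of the family meets at most `8` members, then at small activity inserting one
more member changes the packing sum by at most a factor between `1/2` and `3/2`. -/
theorem packingSum_ratio {P : Finset V → Prop}
    (hdeg : ∀ D : Finset (Finset V), (∀ f ∈ D, P f) → ∀ e, P e →
      (D.filter (fun f => ¬ Disjoint e f)).card ≤ 8)
    {z : 𝕜} (hz : ‖z‖ ≤ 1 / 512) (D : Finset (Finset V)) (hD : ∀ f ∈ D, P f) :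
    packingSum D (fun _ => z) ≠ 0 ∧ ∀ e, P e → e ∉ D →
      ‖packingSum (insert e D) (fun _ => z) - packingSum D (fun _ => z)‖
        ≤ 1 / 2 * ‖packingSum D (fun _ => z)‖ := by
  induction D using Finset.strongInduction with
  | H D ih =>
    have step : ∀ A ⊂ D, ∀ e ∈ D, e ∉ A →
        ‖packingSum A (fun _ => z)‖ ≤ 2 * ‖packingSum (insert e A) (fun _ => z)‖ := by
      intro A hA e he heA
      have h1 := (ih A hA fun f hf => hD f (hA.1 hf)).2 e (hD e he) heA
      have h2 := norm_sub_norm_le (packingSum A fun _ => z) (packingSum (insert e A) fun _ => z)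
      rw [norm_sub_rev] at h2
      linarith
    -- Each insertion shrinks the norm by at most a factor 2, so putting back all of `B` costs at
    -- most 2 to the power `B.card`.
    have many : ∀ A B : Finset (Finset V), A ∪ B ⊆ D → Disjoint A B →
        ‖packingSum A (fun _ => z)‖ ≤ 2 ^ B.card * ‖packingSum (A ∪ B) (fun _ => z)‖ := by
      intro A B
      induction B using Finset.induction_on with
      | empty => simp
      | insert e B he ihB =>
        intro hAB hdis
        rw [Finset.union_insert] at hAB
        have hss : A ∪ B ⊆ D := (Finset.subset_insert _ _).trans hAB
        have heA : e ∉ A := Finset.disjoint_right.1 hdis (Finset.mem_insert_self _ _)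
        have heAB : e ∉ A ∪ B := by simp [heA, he]
        have h1 := ihB hss (hdis.mono_right (Finset.subset_insert _ _))
        have heD : e ∈ D := hAB (Finset.mem_insert_self _ _)
        have h2 := step (A ∪ B) ⟨hss, fun h => heAB (h heD)⟩ e heD heAB
        rw [Finset.card_insert_of_notMem he, Finset.union_insert, pow_succ]
        have h3 : (0 : ℝ) ≤ 2 ^ B.card := by positivity
        nlinarith [mul_le_mul_of_nonneg_left h2 h3]
    constructor
    · rcases D.eq_empty_or_nonempty with rfl | ⟨e, he⟩
      · simp
      · have hss := Finset.erase_ssubset he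
        have h0 := (ih _ hss fun f hf => hD f (hss.1 hf)).1
        have h1 := step _ hss e he (Finset.notMem_erase _ _)
        rw [Finset.insert_erase he] at h1
        intro h
        rw [h, norm_zero, mul_zero] at h1
        exact h0 (norm_le_zero_iff.1 h1)
    · intro e he heD
      rw [packingSum_insert heD, add_sub_cancel_left, norm_mul]
      have h1 := many (D.filter (Disjoint e)) (D.filter (fun f => ¬ Disjoint e f))
        (by rw [Finset.filter_union_filter_not_eq]) (Finset.disjoint_filter_filter_not _ _ _)
      rw [Finset.filter_union_filter_not_eq] at h1
      have h2 : (2 : ℝ) ^ (D.filter (fun f => ¬ Disjoint e f)).card ≤ 2 ^ 8 :=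
        pow_le_pow_right₀ (by norm_num) (hdeg D hD e he)
      have h3 := mul_le_mul_of_nonneg_right h2 (norm_nonneg (packingSum D fun _ => z))
      have h4 : ‖packingSum (D.filter (Disjoint e)) (fun _ => z)‖
          ≤ 256 * ‖packingSum D (fun _ => z)‖ := by linarith
      -- The radius is chosen so that 2^8 / 512 = 1/2, which closes the induction.
      calc _ ≤ 1 / 512 * (256 * ‖packingSum D (fun _ => z)‖) :=
            mul_le_mul hz h4 (norm_nonneg _) (by norm_num)
        _ = _ := by ring

/-- At small positive or negative real activity all packing sums are positive. -/
theorem packingSum_pos {P : Finset V → Prop}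
    (hdeg : ∀ D : Finset (Finset V), (∀ f ∈ D, P f) → ∀ e, P e →
      (D.filter (fun f => ¬ Disjoint e f)).card ≤ 8)
    {z : ℝ} (hz : |z| ≤ 1 / 512) (D : Finset (Finset V)) (hD : ∀ f ∈ D, P f) :
    0 < packingSum D (fun _ => z) := by
  induction D using Finset.induction_on with
  | empty => simp
  | insert e D he ih =>
    have hD' : ∀ f ∈ D, P f := fun f hf => hD f (Finset.mem_insert_of_mem hf)
    have h0 := ih hD'
    have h1 := (packingSum_ratio hdeg (z := z) hz D hD').2 e (hD e (Finset.mem_insert_self _ _)) he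
    rw [Real.norm_eq_abs, Real.norm_eq_abs, abs_of_pos h0] at h1
    linarith [(abs_le.1 h1).1]

theorem differentiable_packingSum (D : Finset (Finset V)) :
    Differentiable ℂ (fun z : ℂ => packingSum D (fun _ => z)) := by
  unfold packingSum
  fun_prop

/-- A bounded holomorphic logarithm of the packing sum near the origin. -/
theorem exists_log_packingSum {P : Finset V → Prop}
    (hdeg : ∀ D : Finset (Finset V), (∀ f ∈ D, P f) → ∀ e, P e →
      (D.filter (fun f => ¬ Disjoint e f)).card ≤ 8)
    (D : Finset (Finset V)) (hD : ∀ f ∈ D, P f) :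
    ∃ l : ℂ → ℂ, DifferentiableOn ℂ l (Metric.ball 0 (1 / 512)) ∧ l 0 = 0 ∧
      ∀ z ∈ Metric.ball (0 : ℂ) (1 / 512),
        Complex.exp (l z) = packingSum D (fun _ => z) ∧ ‖l z‖ ≤ D.card := by
  induction D using Finset.induction_on with
  | empty => exact ⟨fun _ => 0, by fun_prop, rfl, fun z _ => by simp⟩
  | insert e D he ih =>
    have hD' : ∀ f ∈ D, P f := fun f hf => hD f (Finset.mem_insert_of_mem hf)
    obtain ⟨l, hl, hl0, hle⟩ := ih hD'
    -- Relative increment caused by `e`. As its norm is at most 1/2, `1 + g` stays in the right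
    -- half-plane, and its principal logarithm is holomorphic with norm at most 3/4; each member
    -- thus adds at most 1 to the bound.
    set g : ℂ → ℂ := fun z =>
      (packingSum (insert e D) (fun _ => z) - packingSum D (fun _ => z)) /
        packingSum D (fun _ => z) with hg
    have hr : ∀ z ∈ Metric.ball (0 : ℂ) (1 / 512), packingSum D (fun _ => z) ≠ 0 ∧
        ‖g z‖ ≤ 1 / 2 := by
      intro z hz
      rw [mem_ball_zero_iff] at hz
      have h1 := packingSum_ratio hdeg hz.le D hD'
      refine ⟨h1.1, ?_⟩
      rw [hg, norm_div, div_le_iff₀ (norm_pos_iff.2 h1.1)]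
      exact h1.2 e (hD e (Finset.mem_insert_self _ _)) he
    have hslit : ∀ z ∈ Metric.ball (0 : ℂ) (1 / 512), 1 + g z ∈ Complex.slitPlane := by
      intro z hz
      refine Or.inl ?_
      have h1 := (abs_le.1 ((Complex.abs_re_le_norm (g z)).trans (hr z hz).2)).1
      simp only [Complex.add_re, Complex.one_re]
      linarith
    refine ⟨fun z => l z + Complex.log (1 + g z), ?_, ?_, fun z hz => ⟨?_, ?_⟩⟩
    · refine hl.add (DifferentiableOn.clog (DifferentiableOn.const_add _ ?_) hslit)
      exact (((differentiable_packingSum _).sub (differentiable_packingSum _)).differentiableOn).div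
        (differentiable_packingSum _).differentiableOn fun z hz => (hr z hz).1
    · simp [hl0, hg, packingSum_insert he]
    · have h0 := (hr z hz).1
      rw [Complex.exp_add, (hle z hz).1, Complex.exp_log (Complex.slitPlane_ne_zero (hslit z hz)),
        hg]
      field_simp
      ring
    · rw [Finset.card_insert_of_notMem he]
      push_cast
      refine (norm_add_le _ _).trans (add_le_add (hle z hz).2 ?_)
      have := Complex.norm_log_one_add_half_le_self (hr z hz).2
      linarith [(hr z hz).2]

end Ratio


/-! ### Dimers in boxes and the partition function -/

/-- The horizontal dimer whose left cell is `(x, y)`. -/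
def hDimer (x y : ℕ) : Finset (ℕ × ℕ) := {(x, y), (x + 1, y)}

/-- The vertical dimer whose lower cell is `(x, y)`. -/
def vDimer (x y : ℕ) : Finset (ℕ × ℕ) := {(x, y), (x, y + 1)}

theorem isDimer_iff {d : Finset (ℕ × ℕ)} :
    IsDimer d ↔ ∃ x y, d = hDimer x y ∨ d = vDimer x y := by
  constructor
  · rintro ⟨⟨x, y⟩, -, h⟩
    exact ⟨x, y, h⟩
  · rintro ⟨x, y, h | h⟩
    · exact ⟨(x, y), by simp [h, hDimer], Or.inl h⟩
    · exact ⟨(x, y), by simp [h, vDimer], Or.inr h⟩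

theorem hDimer_inj {x y x' y' : ℕ} : hDimer x y = hDimer x' y' ↔ x = x' ∧ y = y' := by
  refine ⟨fun h => ?_, by rintro ⟨rfl, rfl⟩; rfl⟩
  have h1 : (x, y) ∈ hDimer x' y' := h ▸ by simp [hDimer]
  have h2 : (x', y') ∈ hDimer x y := h ▸ by simp [hDimer]
  simp only [hDimer, Finset.mem_insert, Finset.mem_singleton, Prod.mk.injEq] at h1 h2
  omega

theorem vDimer_inj {x y x' y' : ℕ} : vDimer x y = vDimer x' y' ↔ x = x' ∧ y = y' := by
  refine ⟨fun h => ?_, by rintro ⟨rfl, rfl⟩; rfl⟩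
  have h1 : (x, y) ∈ vDimer x' y' := h ▸ by simp [vDimer]
  have h2 : (x', y') ∈ vDimer x y := h ▸ by simp [vDimer]
  simp only [vDimer, Finset.mem_insert, Finset.mem_singleton, Prod.mk.injEq] at h1 h2
  omega

theorem hDimer_ne_vDimer {x y x' y' : ℕ} : hDimer x y ≠ vDimer x' y' := by
  intro h
  have h1 : (x, y) ∈ vDimer x' y' := h ▸ by simp [hDimer]
  have h2 : (x + 1, y) ∈ vDimer x' y' := h ▸ by simp [hDimer]
  simp only [vDimer, Finset.mem_insert, Finset.mem_singleton, Prod.mk.injEq] at h1 h2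
  omega

/-- A dimer has two cells and each cell lies in at most four dimers. The bound is not sharp, since
`e` itself may be counted twice. -/
theorem card_filter_not_disjoint_le (D : Finset (Finset (ℕ × ℕ))) (hD : ∀ f ∈ D, IsDimer f)
    (e : Finset (ℕ × ℕ)) (he : IsDimer e) : (D.filter (fun f => ¬ Disjoint e f)).card ≤ 8 := by
  have cell : ∀ p : ℕ × ℕ, (D.filter (fun f => p ∈ f)).card ≤ 4 := by
    rintro ⟨x, y⟩
    refine (Finset.card_le_card (t := {hDimer x y, hDimer (x - 1) y, vDimer x y,
      vDimer x (y - 1)}) ?_).trans Finset.card_le_four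
    intro f hf
    rw [Finset.mem_filter] at hf
    obtain ⟨a, b, rfl | rfl⟩ := isDimer_iff.1 (hD f hf.1)
    · have h := hf.2
      simp only [hDimer, Finset.mem_insert, Finset.mem_singleton, Prod.mk.injEq] at h
      simp only [Finset.mem_insert, Finset.mem_singleton, hDimer_inj]
      omega
    · have h := hf.2
      simp only [vDimer, Finset.mem_insert, Finset.mem_singleton, Prod.mk.injEq] at h
      simp only [Finset.mem_insert, Finset.mem_singleton, vDimer_inj]
      omega
  have two : ∃ p q : ℕ × ℕ, e = {p, q} := by
    obtain ⟨x, y, rfl | rfl⟩ := isDimer_iff.1 he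
    exacts [⟨_, _, rfl⟩, ⟨_, _, rfl⟩]
  obtain ⟨p, q, rfl⟩ := two
  have : D.filter (fun f => ¬ Disjoint {p, q} f)
      ⊆ D.filter (fun f => p ∈ f) ∪ D.filter (fun f => q ∈ f) := by
    intro f hf
    simp only [Finset.mem_filter, Finset.disjoint_insert_left, Finset.disjoint_singleton_left,
      Finset.mem_union] at hf ⊢
    tauto
  calc _ ≤ _ := Finset.card_le_card this
    _ ≤ _ := Finset.card_union_le _ _
    _ ≤ 8 := by linarith [cell p, cell q]

/-- The dimers contained in `[a, a') × [b, b')`. -/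
def boxDimers (a a' b b' : ℕ) : Finset (Finset (ℕ × ℕ)) :=
  (Finset.Ico a a' ×ˢ Finset.Ico b b').powerset.filter IsDimer

theorem mem_boxDimers {a a' b b' : ℕ} {d : Finset (ℕ × ℕ)} : d ∈ boxDimers a a' b b' ↔
    (∃ x y, d = hDimer x y ∧ a ≤ x ∧ x + 1 < a' ∧ b ≤ y ∧ y < b') ∨
    (∃ x y, d = vDimer x y ∧ a ≤ x ∧ x < a' ∧ b ≤ y ∧ y + 1 < b') := by
  simp only [boxDimers, Finset.mem_filter, Finset.mem_powerset, isDimer_iff]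
  constructor
  · rintro ⟨hs, x, y, rfl | rfl⟩
    · left
      simp only [hDimer, Finset.insert_subset_iff, Finset.singleton_subset_iff, Finset.mem_product,
        Finset.mem_Ico] at hs
      exact ⟨x, y, rfl, by omega⟩
    · right
      simp only [vDimer, Finset.insert_subset_iff, Finset.singleton_subset_iff, Finset.mem_product,
        Finset.mem_Ico] at hs
      exact ⟨x, y, rfl, by omega⟩
  · rintro (⟨x, y, rfl, h⟩ | ⟨x, y, rfl, h⟩)
    · refine ⟨?_, x, y, Or.inl rfl⟩
      simp only [hDimer, Finset.insert_subset_iff, Finset.singleton_subset_iff, Finset.mem_product,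
        Finset.mem_Ico]
      omega
    · refine ⟨?_, x, y, Or.inr rfl⟩
      simp only [vDimer, Finset.insert_subset_iff, Finset.singleton_subset_iff, Finset.mem_product,
        Finset.mem_Ico]
      omega

theorem dimers_eq_boxDimers (m n : ℕ) : dimers m n = boxDimers 0 m 0 n := by
  simp [dimers, boxDimers, rect]

theorem isDimer_of_mem_dimers {m n : ℕ} : ∀ d ∈ dimers m n, IsDimer d :=
  fun _ hd => (Finset.mem_filter.1 hd).2

theorem isDimer_of_mem_boxDimers {a a' b b' : ℕ} : ∀ d ∈ boxDimers a a' b b', IsDimer d :=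
  fun _ hd => (Finset.mem_filter.1 hd).2

theorem card_dimers_le (m n : ℕ) : (dimers m n).card ≤ 2 * (m * n) := by
  have : dimers m n ⊆ (Finset.range m ×ˢ Finset.range n).image (fun p => hDimer p.1 p.2)
      ∪ (Finset.range m ×ˢ Finset.range n).image (fun p => vDimer p.1 p.2) := by
    intro d hd
    rw [dimers_eq_boxDimers, mem_boxDimers] at hd
    simp only [Finset.mem_union, Finset.mem_image, Finset.mem_product, Finset.mem_range,
      Prod.exists]
    rcases hd with ⟨x, y, rfl, h⟩ | ⟨x, y, rfl, h⟩
    · exact Or.inl ⟨x, y, by omega, rfl⟩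
    · exact Or.inr ⟨x, y, by omega, rfl⟩
  calc _ ≤ _ := Finset.card_le_card this
    _ ≤ _ := Finset.card_union_le _ _
    _ ≤ _ := add_le_add Finset.card_image_le Finset.card_image_le
    _ = _ := by simp [two_mul]

theorem image_add_hDimer (u v x y : ℕ) :
    (hDimer x y).image (fun p => (p.1 + u, p.2 + v)) = hDimer (x + u) (y + v) := by
  simp [hDimer, Finset.image_insert, add_right_comm]

theorem image_add_vDimer (u v x y : ℕ) :
    (vDimer x y).image (fun p => (p.1 + u, p.2 + v)) = vDimer (x + u) (y + v) := by
  simp [vDimer, Finset.image_insert, add_right_comm]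

theorem boxDimers_eq_image (a a' b b' : ℕ) :
    boxDimers a a' b b' = (dimers (a' - a) (b' - b)).image
      (Finset.image (fun p : ℕ × ℕ => (p.1 + a, p.2 + b))) := by
  ext d
  rw [dimers_eq_boxDimers, Finset.mem_image, mem_boxDimers]
  constructor
  · rintro (⟨x, y, rfl, h⟩ | ⟨x, y, rfl, h⟩)
    · refine ⟨hDimer (x - a) (y - b), mem_boxDimers.2 (Or.inl ⟨_, _, rfl, by omega⟩), ?_⟩
      rw [image_add_hDimer, Nat.sub_add_cancel h.1, Nat.sub_add_cancel h.2.2.1]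
    · refine ⟨vDimer (x - a) (y - b), mem_boxDimers.2 (Or.inr ⟨_, _, rfl, by omega⟩), ?_⟩
      rw [image_add_vDimer, Nat.sub_add_cancel h.1, Nat.sub_add_cancel h.2.2.1]
  · rintro ⟨d, hd, rfl⟩
    rcases mem_boxDimers.1 hd with ⟨x, y, rfl, h⟩ | ⟨x, y, rfl, h⟩
    · exact Or.inl ⟨x + a, y + b, image_add_hDimer _ _ _ _, by omega⟩
    · exact Or.inr ⟨x + a, y + b, image_add_vDimer _ _ _ _, by omega⟩

theorem packingSum_boxDimers {R : Type*} [CommSemiring R] (a a' b b' : ℕ) (z : R) :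
    packingSum (boxDimers a a' b b') (fun _ => z)
      = packingSum (dimers (a' - a) (b' - b)) (fun _ => z) := by
  rw [boxDimers_eq_image, packingSum_image]
  rintro ⟨x, y⟩ ⟨x', y'⟩ h
  simpa using h

theorem dimers_swap (m n : ℕ) : dimers n m = (dimers m n).image (Finset.image Prod.swap) := by
  have h1 : ∀ x y, (hDimer x y).image Prod.swap = vDimer y x := by
    intro x y; simp [hDimer, vDimer, Finset.image_insert]
  have h2 : ∀ x y, (vDimer x y).image Prod.swap = hDimer y x := by
    intro x y; simp [hDimer, vDimer, Finset.image_insert]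
  ext d
  rw [dimers_eq_boxDimers, dimers_eq_boxDimers, Finset.mem_image, mem_boxDimers]
  constructor
  · rintro (⟨x, y, rfl, h⟩ | ⟨x, y, rfl, h⟩)
    · exact ⟨_, mem_boxDimers.2 (Or.inr ⟨y, x, rfl, by omega⟩), h2 _ _⟩
    · exact ⟨_, mem_boxDimers.2 (Or.inl ⟨y, x, rfl, by omega⟩), h1 _ _⟩
  · rintro ⟨d, hd, rfl⟩
    rcases mem_boxDimers.1 hd with ⟨x, y, rfl, h⟩ | ⟨x, y, rfl, h⟩
    · exact Or.inr ⟨y, x, h1 _ _, by omega⟩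
    · exact Or.inl ⟨y, x, h2 _ _, by omega⟩

theorem packingSum_dimers_swap {R : Type*} [CommSemiring R] (m n : ℕ) (z : R) :
    packingSum (dimers n m) (fun _ => z) = packingSum (dimers m n) (fun _ => z) := by
  rw [dimers_swap, packingSum_image Prod.swap_injective]

theorem dimers_zero_left (n : ℕ) : dimers 0 n = ∅ := by
  ext d
  simp only [dimers_eq_boxDimers, mem_boxDimers, Finset.notMem_empty, iff_false]
  rintro (⟨x, y, -, h⟩ | ⟨x, y, -, h⟩) <;> omega

theorem dimers_zero_right (n : ℕ) : dimers n 0 = ∅ := by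
  rw [dimers_swap, dimers_zero_left, Finset.image_empty]

theorem disjoint_boxDimers_of_fst {a a' b b' u u' v v' : ℕ} (h : a' ≤ u) :
    ∀ d ∈ boxDimers a a' b b', ∀ e ∈ boxDimers u u' v v', Disjoint d e := by
  intro d hd e he
  simp only [boxDimers, Finset.mem_filter, Finset.mem_powerset] at hd he
  rw [Finset.disjoint_left]
  intro p hp hq
  have h1 := hd.1 hp
  have h2 := he.1 hq
  simp only [Finset.mem_product, Finset.mem_Ico] at h1 h2
  omega

theorem disjoint_boxDimers_of_snd {a a' b b' u u' v v' : ℕ} (h : b' ≤ v) :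
    ∀ d ∈ boxDimers a a' b b', ∀ e ∈ boxDimers u u' v v', Disjoint d e := by
  intro d hd e he
  simp only [boxDimers, Finset.mem_filter, Finset.mem_powerset] at hd he
  rw [Finset.disjoint_left]
  intro p hp hq
  have h1 := hd.1 hp
  have h2 := he.1 hq
  simp only [Finset.mem_product, Finset.mem_Ico] at h1 h2
  omega

theorem disjoint_of_pairwise_disjoint {A B : Finset (Finset (ℕ × ℕ))}
    (hA : ∀ d ∈ A, IsDimer d) (h : ∀ d ∈ A, ∀ e ∈ B, Disjoint d e) : Disjoint A B := by
  rw [Finset.disjoint_left]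
  intro d hd hd'
  obtain ⟨p, hp, -⟩ := hA d hd
  exact Finset.disjoint_left.1 (h d hd d hd') hp hp

/-- The partition function is the packing sum of the dimers of the rectangle. -/
theorem partitionFn_eq_packingSum (m n : ℕ) (z : ℝ) :
    partitionFn m n z = packingSum (dimers m n) (fun _ => z) := by
  unfold partitionFn packingSum
  have hmem : ∀ T ∈ (dimers m n).powerset.filter
      (fun T => ∀ d ∈ T, ∀ e ∈ T, d ≠ e → Disjoint d e),
      T.card ∈ Finset.range (m * n / 2 + 1) := by
    intro T hT
    rw [Finset.mem_filter, Finset.mem_powerset] at hT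
    -- Disjoint dimers cover twice as many cells as there are dimers, so the cutoff `m * n / 2`
    -- loses no packing.
    have hcard : (T.biUnion id).card = ∑ d ∈ T, d.card :=
      Finset.card_biUnion fun d hd e he hde => hT.2 d hd e he hde
    have htwo : ∑ d ∈ T, d.card = T.card * 2 := by
      refine Finset.sum_const_nat fun d hd => ?_
      obtain ⟨x, y, rfl | rfl⟩ := isDimer_iff.1 (isDimer_of_mem_dimers d (hT.1 hd))
      · exact Finset.card_pair (by simp)
      · exact Finset.card_pair (by simp)
    have hle : (T.biUnion id).card ≤ (rect m n).card := by
      refine Finset.card_le_card (Finset.biUnion_subset.2 fun d hd => ?_)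
      exact Finset.mem_powerset.1 (Finset.mem_filter.1 (hT.1 hd)).1
    have hrect : (rect m n).card = m * n := by simp [rect]
    rw [Finset.mem_range]
    omega
  rw [← Finset.sum_fiberwise_of_maps_to hmem]
  refine Finset.sum_congr rfl fun s _ => ?_
  have : ((dimers m n).powerset.filter
      (fun T => ∀ d ∈ T, ∀ e ∈ T, d ≠ e → Disjoint d e)).filter (fun T => T.card = s)
      = tilings m n s := by
    ext T
    simp only [tilings, Finset.mem_filter, Finset.mem_powerset, Finset.mem_powersetCard]
    tauto
  rw [this, ← nsmul_eq_mul]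
  refine (Finset.sum_eq_card_nsmul fun T hT => ?_).symm
  rw [Finset.prod_const]
  simp only [tilings, Finset.mem_filter, Finset.mem_powersetCard] at hT
  rw [hT.1.2]

/-! ### Factorization along uncrossed grid lines -/

/-- A family of dimers none of which crosses a vertical line splits at that line. -/
theorem packingSum_split_fst {R : Type*} [CommSemiring R] {D : Finset (Finset (ℕ × ℕ))} {c : ℕ}
    (hc : ∀ y, hDimer c y ∉ D) {a a' : ℕ} (ha : a ≤ c + 1) (ha' : c + 1 ≤ a') (b b' : ℕ)
    (x : Finset (ℕ × ℕ) → R) :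
    packingSum (boxDimers a a' b b' ∩ D) x =
      packingSum (boxDimers a (c + 1) b b' ∩ D) x *
        packingSum (boxDimers (c + 1) a' b b' ∩ D) x := by
  have hcross : ∀ d ∈ boxDimers a (c + 1) b b' ∩ D, ∀ e ∈ boxDimers (c + 1) a' b b' ∩ D,
      Disjoint d e := fun d hd e he => disjoint_boxDimers_of_fst le_rfl d
    (Finset.mem_inter.1 hd).1 e (Finset.mem_inter.1 he).1
  rw [← packingSum_union (disjoint_of_pairwise_disjoint (fun d hd =>
    isDimer_of_mem_boxDimers d (Finset.mem_inter.1 hd).1) hcross) hcross]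
  congr 1
  ext d
  simp only [Finset.mem_union, Finset.mem_inter, ← or_and_right]
  refine and_congr_left fun hd => ?_
  simp only [mem_boxDimers]
  constructor
  · rintro (⟨x, y, rfl, h⟩ | ⟨x, y, rfl, h⟩)
    · have hxc : x ≠ c := by rintro rfl; exact hc y hd
      rcases Nat.lt_or_ge x (c + 1) with h1 | h1
      · exact Or.inl (Or.inl ⟨x, y, rfl, by omega⟩)
      · exact Or.inr (Or.inl ⟨x, y, rfl, by omega⟩)
    · rcases Nat.lt_or_ge x (c + 1) with h1 | h1
      · exact Or.inl (Or.inr ⟨x, y, rfl, by omega⟩)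
      · exact Or.inr (Or.inr ⟨x, y, rfl, by omega⟩)
  · rintro ((⟨x, y, rfl, h⟩ | ⟨x, y, rfl, h⟩) | (⟨x, y, rfl, h⟩ | ⟨x, y, rfl, h⟩))
    · exact Or.inl ⟨x, y, rfl, by omega⟩
    · exact Or.inr ⟨x, y, rfl, by omega⟩
    · exact Or.inl ⟨x, y, rfl, by omega⟩
    · exact Or.inr ⟨x, y, rfl, by omega⟩

/-- A family of dimers none of which crosses a horizontal line splits at that line. -/
theorem packingSum_split_snd {R : Type*} [CommSemiring R] {D : Finset (Finset (ℕ × ℕ))} {c : ℕ}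
    (hc : ∀ x, vDimer x c ∉ D) {b b' : ℕ} (hb : b ≤ c + 1) (hb' : c + 1 ≤ b') (a a' : ℕ)
    (x : Finset (ℕ × ℕ) → R) :
    packingSum (boxDimers a a' b b' ∩ D) x =
      packingSum (boxDimers a a' b (c + 1) ∩ D) x *
        packingSum (boxDimers a a' (c + 1) b' ∩ D) x := by
  have hcross : ∀ d ∈ boxDimers a a' b (c + 1) ∩ D, ∀ e ∈ boxDimers a a' (c + 1) b' ∩ D,
      Disjoint d e := fun d hd e he => disjoint_boxDimers_of_snd le_rfl d
    (Finset.mem_inter.1 hd).1 e (Finset.mem_inter.1 he).1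
  rw [← packingSum_union (disjoint_of_pairwise_disjoint (fun d hd =>
    isDimer_of_mem_boxDimers d (Finset.mem_inter.1 hd).1) hcross) hcross]
  congr 1
  ext d
  simp only [Finset.mem_union, Finset.mem_inter, ← or_and_right]
  refine and_congr_left fun hd => ?_
  simp only [mem_boxDimers]
  constructor
  · rintro (⟨x, y, rfl, h⟩ | ⟨x, y, rfl, h⟩)
    · rcases Nat.lt_or_ge y (c + 1) with h1 | h1
      · exact Or.inl (Or.inl ⟨x, y, rfl, by omega⟩)
      · exact Or.inr (Or.inl ⟨x, y, rfl, by omega⟩)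
    · have hxc : y ≠ c := by rintro rfl; exact hc x hd
      rcases Nat.lt_or_ge y (c + 1) with h1 | h1
      · exact Or.inl (Or.inr ⟨x, y, rfl, by omega⟩)
      · exact Or.inr (Or.inr ⟨x, y, rfl, by omega⟩)
  · rintro ((⟨x, y, rfl, h⟩ | ⟨x, y, rfl, h⟩) | (⟨x, y, rfl, h⟩ | ⟨x, y, rfl, h⟩))
    · exact Or.inl ⟨x, y, rfl, by omega⟩
    · exact Or.inr ⟨x, y, rfl, by omega⟩
    · exact Or.inl ⟨x, y, rfl, by omega⟩
    · exact Or.inr ⟨x, y, rfl, by omega⟩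

/-- A family of fewer than `i + j` dimers misses one of `i` vertical and `j` horizontal lines. -/
theorem exists_uncrossed_line {D : Finset (Finset (ℕ × ℕ))} {i j : ℕ} (hD : D.card < i + j) :
    (∃ c < i, ∀ y, hDimer c y ∉ D) ∨ (∃ c < j, ∀ x, vDimer x c ∉ D) := by
  by_contra! h
  choose! f hf using h.1
  choose! g hg using h.2
  -- A dimer crosses exactly one grid line, so dimers chosen for different lines are distinct.
  have h1 : ((Finset.range i).image (fun c => hDimer c (f c))
      ∪ (Finset.range j).image (fun c => vDimer (g c) c)).card = i + j := by
    rw [Finset.card_union_of_disjoint, Finset.card_image_of_injective,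
      Finset.card_image_of_injective, Finset.card_range, Finset.card_range]
    · intro c c' h; exact (vDimer_inj.1 h).2
    · intro c c' h; exact (hDimer_inj.1 h).1
    · rw [Finset.disjoint_left]
      simp only [Finset.mem_image, not_exists, not_and]
      rintro _ ⟨c, -, rfl⟩ c' - h
      exact hDimer_ne_vDimer h.symm
  have h2 : (Finset.range i).image (fun c => hDimer c (f c))
      ∪ (Finset.range j).image (fun c => vDimer (g c) c) ⊆ D := by
    intro d hd
    simp only [Finset.mem_union, Finset.mem_image, Finset.mem_range] at hd
    rcases hd with ⟨c, hc, rfl⟩ | ⟨c, hc, rfl⟩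
    · exact hf c hc
    · exact hg c hc
  have := Finset.card_le_card h2
  omega


/-! ### Order of vanishing from restrictions of variables -/

section Polynomial

variable {σ : Type*} [DecidableEq σ]

theorem coeff_aeval_ite (D : Finset σ) {α : σ →₀ ℕ} (hα : α.support ⊆ D)
    (p : MvPolynomial σ ℂ) :
    MvPolynomial.coeff α (MvPolynomial.aeval
      (fun e => if e ∈ D then (MvPolynomial.X e : MvPolynomial σ ℂ) else 0) p)
      = MvPolynomial.coeff α p := by
  induction p using MvPolynomial.induction_on' with
  | monomial β c =>
    rw [MvPolynomial.aeval_monomial]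
    by_cases hβ : β.support ⊆ D
    · have : (β.prod fun e n => (if e ∈ D then (MvPolynomial.X e : MvPolynomial σ ℂ) else 0) ^ n)
          = β.prod fun e n => MvPolynomial.X e ^ n :=
        Finset.prod_congr rfl fun e he => by simp only [if_pos (hβ he)]
      rw [this, MvPolynomial.monomial_eq, MvPolynomial.algebraMap_eq]
    · obtain ⟨e, he, heD⟩ := Finset.not_subset.1 hβ
      have : (β.prod fun e n => (if e ∈ D then (MvPolynomial.X e : MvPolynomial σ ℂ) else 0) ^ n)
          = 0 := by
        refine Finset.prod_eq_zero he ?_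
        simp only [if_neg heD]
        exact zero_pow (Finsupp.mem_support_iff.1 he)
      have hne : β ≠ α := by rintro rfl; exact hβ hα
      rw [this, mul_zero, MvPolynomial.coeff_monomial, if_neg hne, MvPolynomial.coeff_zero]
  | add p q hp hq => rw [map_add, MvPolynomial.coeff_add, MvPolynomial.coeff_add, hp, hq]

/-- A polynomial that vanishes whenever all but fewer than `k` variables are set to zero
has order at least `k` along the diagonal. -/
theorem isBigO_aeval_of_restrict_eq_zero {k : ℕ} (p : MvPolynomial σ ℂ)
    (hp : ∀ D : Finset σ, D.card < k → MvPolynomial.aeval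
      (fun e => if e ∈ D then (MvPolynomial.X e : MvPolynomial σ ℂ) else 0) p = 0) :
    (fun z : ℂ => MvPolynomial.aeval (fun _ => z) p) =O[𝓝 0] fun z => z ^ k := by
  simp only [MvPolynomial.aeval_def, MvPolynomial.eval₂_eq]
  apply IsBigO.fun_sum
  intro α hα
  -- A monomial of degree below `k` has fewer than `k` variables. Restriction to those variables
  -- keeps its coefficient, yet makes `p` zero.
  have hdeg : k ≤ ∑ e ∈ α.support, α e := by
    by_contra! h
    have hcard : α.support.card < k := by
      refine lt_of_le_of_lt ?_ h
      rw [Finset.card_eq_sum_ones]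
      exact Finset.sum_le_sum fun e he => Nat.one_le_iff_ne_zero.2 (Finsupp.mem_support_iff.1 he)
    refine MvPolynomial.mem_support_iff.1 hα ?_
    rw [← coeff_aeval_ite α.support subset_rfl, hp _ hcard, MvPolynomial.coeff_zero]
  simp only [Finset.prod_pow_eq_pow_sum]
  refine IsBigO.const_mul_left ?_ _
  obtain ⟨t, ht⟩ := Nat.exists_eq_add_of_le hdeg
  rw [ht]
  simp only [pow_add]
  have : (fun z : ℂ => z ^ t) =O[𝓝 0] fun _ => (1 : ℂ) :=
    (continuous_pow t).continuousAt.isBigO_one ℂ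
  simpa using (isBigO_refl (fun z : ℂ => z ^ k) (𝓝 0)).mul this

end Polynomial

/-! ### Inclusion-exclusion over sixteen boxes -/

section Alternating

variable {R : Type*} [CommRing R]

/-- The factors with positive sign in the inclusion-exclusion over the sides of a box. -/
def evenProd (U : ℕ → ℕ → ℕ → ℕ → R) (i j : ℕ) : R :=
  (U 0 (i + 1) 0 (j + 1) * U 1 i 0 (j + 1)) * (U 0 (i + 1) 1 j * U 1 i 1 j) *
    (U 1 (i + 1) 1 (j + 1) * U 0 i 1 (j + 1)) * (U 1 (i + 1) 0 j * U 0 i 0 j)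

/-- The factors with negative sign in the inclusion-exclusion over the sides of a box. -/
def oddProd (U : ℕ → ℕ → ℕ → ℕ → R) (i j : ℕ) : R :=
  (U 1 (i + 1) 0 (j + 1) * U 0 i 0 (j + 1)) * (U 1 (i + 1) 1 j * U 0 i 1 j) *
    (U 0 (i + 1) 1 (j + 1) * U 1 i 1 (j + 1)) * (U 0 (i + 1) 0 j * U 1 i 0 j)

/-- Along an uncrossed line every box sum is a product of two factors, one depending on the near end
of the interval and one on the far end. Exchanging the ends between two boxes then leaves their
product unchanged. -/
theorem evenProd_eq_oddProd_of_card_lt {D : Finset (Finset (ℕ × ℕ))} {i j : ℕ}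
    (hD : D.card < i + j) (x : Finset (ℕ × ℕ) → R) :
    evenProd (fun a a' b b' => packingSum (boxDimers a a' b b' ∩ D) x) i j
      = oddProd (fun a a' b b' => packingSum (boxDimers a a' b b' ∩ D) x) i j := by
  unfold evenProd oddProd
  rcases exists_uncrossed_line hD with ⟨c, hci, hc⟩ | ⟨c, hcj, hc⟩
  · have key : ∀ b b', packingSum (boxDimers 0 (i + 1) b b' ∩ D) x *
        packingSum (boxDimers 1 i b b' ∩ D) x = packingSum (boxDimers 1 (i + 1) b b' ∩ D) x *
        packingSum (boxDimers 0 i b b' ∩ D) x := by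
      intro b b'
      rw [packingSum_split_fst hc (a := 0) (a' := i + 1) (by omega) (by omega),
        packingSum_split_fst hc (a := 1) (a' := i) (by omega) (by omega),
        packingSum_split_fst hc (a := 1) (a' := i + 1) (by omega) (by omega),
        packingSum_split_fst hc (a := 0) (a' := i) (by omega) (by omega)]
      ring
    simp only [key]
  · have key : ∀ a a', packingSum (boxDimers a a' 0 (j + 1) ∩ D) x *
        packingSum (boxDimers a a' 1 j ∩ D) x = packingSum (boxDimers a a' 1 (j + 1) ∩ D) x *
        packingSum (boxDimers a a' 0 j ∩ D) x := by
      intro a a'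
      rw [packingSum_split_snd hc (b := 0) (b' := j + 1) (by omega) (by omega),
        packingSum_split_snd hc (b := 1) (b' := j) (by omega) (by omega),
        packingSum_split_snd hc (b := 1) (b' := j + 1) (by omega) (by omega),
        packingSum_split_snd hc (b := 0) (b' := j) (by omega) (by omega)]
      ring
    -- The factors are grouped for vertical cuts. For a horizontal cut the identity is applied to
    -- the four column intervals in turn, replacing one pair of factors at a time.
    linear_combination
      (packingSum (boxDimers 1 i 0 (j + 1) ∩ D) x * packingSum (boxDimers 1 i 1 j ∩ D) x *
        packingSum (boxDimers 1 (i + 1) 1 (j + 1) ∩ D) x * packingSum (boxDimers 0 i 1 (j + 1) ∩ D) x *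
        packingSum (boxDimers 1 (i + 1) 0 j ∩ D) x * packingSum (boxDimers 0 i 0 j ∩ D) x)
        * key 0 (i + 1) +
      (packingSum (boxDimers 0 (i + 1) 1 (j + 1) ∩ D) x *
        packingSum (boxDimers 0 (i + 1) 0 j ∩ D) x *
        packingSum (boxDimers 1 (i + 1) 1 (j + 1) ∩ D) x * packingSum (boxDimers 0 i 1 (j + 1) ∩ D) x *
        packingSum (boxDimers 1 (i + 1) 0 j ∩ D) x * packingSum (boxDimers 0 i 0 j ∩ D) x)
        * key 1 i -
      (packingSum (boxDimers 0 (i + 1) 1 (j + 1) ∩ D) x *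
        packingSum (boxDimers 0 (i + 1) 0 j ∩ D) x *
        packingSum (boxDimers 1 i 1 (j + 1) ∩ D) x * packingSum (boxDimers 1 i 0 j ∩ D) x *
        packingSum (boxDimers 0 i 1 (j + 1) ∩ D) x * packingSum (boxDimers 0 i 0 j ∩ D) x)
        * key 1 (i + 1) -
      (packingSum (boxDimers 0 (i + 1) 1 (j + 1) ∩ D) x *
        packingSum (boxDimers 0 (i + 1) 0 j ∩ D) x *
        packingSum (boxDimers 1 i 1 (j + 1) ∩ D) x * packingSum (boxDimers 1 i 0 j ∩ D) x *
        packingSum (boxDimers 1 (i + 1) 0 (j + 1) ∩ D) x * packingSum (boxDimers 1 (i + 1) 1 j ∩ D) x)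
        * key 0 i

theorem map_evenProd {S F : Type*} [CommRing S] [FunLike F R S] [RingHomClass F R S] (φ : F)
    (U : ℕ → ℕ → ℕ → ℕ → R) (i j : ℕ) :
    φ (evenProd U i j) = evenProd (fun a a' b b' => φ (U a a' b b')) i j := by
  simp only [evenProd, map_mul]

theorem map_oddProd {S F : Type*} [CommRing S] [FunLike F R S] [RingHomClass F R S] (φ : F)
    (U : ℕ → ℕ → ℕ → ℕ → R) (i j : ℕ) :
    φ (oddProd U i j) = oddProd (fun a a' b b' => φ (U a a' b b')) i j := by
  simp only [oddProd, map_mul]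

end Alternating

/-- The inclusion-exclusion products over the sides of an `(i + 1) × (j + 1)` box agree up to
order `i + j`. -/
theorem isBigO_evenProd_sub_oddProd (i j : ℕ) :
    (fun z : ℂ => evenProd (fun a a' b b' => packingSum (boxDimers a a' b b') (fun _ => z)) i j -
      oddProd (fun a a' b b' => packingSum (boxDimers a a' b b') (fun _ => z)) i j)
      =O[𝓝 0] fun z => z ^ (i + j) := by
  -- One variable per dimer; the diagonal evaluation recovers the uniform activity `z`.
  have h := isBigO_aeval_of_restrict_eq_zero (k := i + j)
    (evenProd (fun a a' b b' => packingSum (boxDimers a a' b b')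
        (MvPolynomial.X : Finset (ℕ × ℕ) → MvPolynomial (Finset (ℕ × ℕ)) ℂ)) i j -
      oddProd (fun a a' b b' => packingSum (boxDimers a a' b b')
        (MvPolynomial.X : Finset (ℕ × ℕ) → MvPolynomial (Finset (ℕ × ℕ)) ℂ)) i j) ?_
  · simpa only [map_sub, map_evenProd, map_oddProd, map_packingSum, MvPolynomial.aeval_X] using h
  · intro D hD
    simp only [map_sub, map_evenProd, map_oddProd, map_packingSum, MvPolynomial.aeval_X,
      packingSum_ite]
    rw [evenProd_eq_oddProd_of_card_lt hD, sub_self]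

/-- For |w| < 1/2 the quadratic remainder of exp is at most |w|/2, whence |w| ≤ 2 |exp w - 1|. -/
theorem isBigO_of_exp_sub_one {w g : ℂ → ℂ} (hw : ContinuousAt w 0) (hw0 : w 0 = 0)
    (h : (fun z => Complex.exp (w z) - 1) =O[𝓝 0] g) : w =O[𝓝 0] g := by
  refine IsBigO.trans ?_ h
  have hev : ∀ᶠ z in 𝓝 (0 : ℂ), ‖w z‖ < 1 / 2 := by
    have : Tendsto (fun z => ‖w z‖) (𝓝 0) (𝓝 0) := by
      simpa [hw0] using hw.norm.tendsto
    exact this.eventually_lt_const (by norm_num)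
  refine IsBigO.of_bound 2 (hev.mono fun z hz => ?_)
  have h1 := Complex.norm_exp_sub_one_sub_id_le (x := w z) (by linarith)
  have h2 := norm_sub_norm_le (w z) (Complex.exp (w z) - 1)
  rw [norm_sub_rev (w z)] at h2
  nlinarith [norm_nonneg (w z)]

theorem exists_log_dimers : ∃ l : ℕ → ℕ → ℂ → ℂ, ∀ m n,
    DifferentiableOn ℂ (l m n) (Metric.ball 0 (1 / 512)) ∧ l m n 0 = 0 ∧
      ∀ z ∈ Metric.ball (0 : ℂ) (1 / 512),
        Complex.exp (l m n z) = packingSum (dimers m n) (fun _ => z) ∧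
          ‖l m n z‖ ≤ 2 * (m * n) := by
  have h := fun m n => exists_log_packingSum card_filter_not_disjoint_le (dimers m n)
    isDimer_of_mem_dimers
  choose l h1 h2 h3 using h
  refine ⟨l, fun m n => ⟨h1 m n, h2 m n, fun z hz => ⟨(h3 m n z hz).1, ?_⟩⟩⟩
  exact (h3 m n z hz).2.trans (by exact_mod_cast card_dimers_le m n)

/-! ### Decay of the weights -/

/-- The mixed second difference of a function of two sizes, centred at `(i, j)`. -/
def mixedDiff {E : Type*} [AddCommGroup E] (f : ℕ → ℕ → E) (i j : ℕ) : E :=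
  (f (i + 1) (j + 1) - 2 • f i (j + 1) + f (i - 1) (j + 1))
    - 2 • (f (i + 1) j - 2 • f i j + f (i - 1) j)
    + (f (i + 1) (j - 1) - 2 • f i (j - 1) + f (i - 1) (j - 1))

section Weights

variable {l : ℕ → ℕ → ℂ → ℂ}

theorem differentiableOn_mixedDiff
    (hd : ∀ m n, DifferentiableOn ℂ (l m n) (Metric.ball 0 (1 / 512))) (i j : ℕ) :
    DifferentiableOn ℂ (fun z => mixedDiff (fun m n => l m n z) i j) (Metric.ball 0 (1 / 512)) := by
  unfold mixedDiff
  have h2 : ∀ m n, DifferentiableOn ℂ (fun z => l m n z) (Metric.ball 0 (1 / 512)) := hd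
  fun_prop

/-- By translation invariance only side lengths matter. The intervals from 0 or 1 to i or i+1 have
lengths i+1, i, i, i-1, which produces the coefficients 1, -2, 1 in each direction. Truncation at i
= 0 agrees with the empty interval from 1 to 0. -/
theorem exp_mixedDiff
    (he : ∀ m n, ∀ z ∈ Metric.ball (0 : ℂ) (1 / 512),
      Complex.exp (l m n z) = packingSum (dimers m n) (fun _ => z)) (i j : ℕ)
    {z : ℂ} (hz : z ∈ Metric.ball (0 : ℂ) (1 / 512)) :
    Complex.exp (mixedDiff (fun m n => l m n z) i j) =
      evenProd (fun a a' b b' => packingSum (boxDimers a a' b b') (fun _ => z)) i j /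
      oddProd (fun a a' b b' => packingSum (boxDimers a a' b b') (fun _ => z)) i j := by
  have hbox : ∀ a a' b b', packingSum (boxDimers a a' b b') (fun _ => z)
      = Complex.exp (l (a' - a) (b' - b) z) := by
    intro a a' b b'
    rw [packingSum_boxDimers, he _ _ z hz]
  simp only [evenProd, oddProd, hbox, ← Complex.exp_add, ← Complex.exp_sub]
  congr 1
  simp only [mixedDiff, Nat.sub_zero, Nat.add_sub_cancel]
  ring

theorem isBigO_mixedDiff
    (hd : ∀ m n, DifferentiableOn ℂ (l m n) (Metric.ball 0 (1 / 512)))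
    (h0 : ∀ m n, l m n 0 = 0)
    (he : ∀ m n, ∀ z ∈ Metric.ball (0 : ℂ) (1 / 512),
      Complex.exp (l m n z) = packingSum (dimers m n) (fun _ => z)) (i j : ℕ) :
    (fun z => mixedDiff (fun m n => l m n z) i j) =O[𝓝 0] fun z => z ^ (i + j) := by
  have hball : Metric.ball (0 : ℂ) (1 / 512) ∈ 𝓝 0 := Metric.ball_mem_nhds _ (by norm_num)
  refine isBigO_of_exp_sub_one
    ((differentiableOn_mixedDiff hd i j).differentiableAt hball).continuousAt
    (by simp [mixedDiff, h0]) ?_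
  set Q : ℂ → ℂ := fun z =>
    oddProd (fun a a' b b' => packingSum (boxDimers a a' b b') (fun _ => z)) i j with hQ
  have hQc : Continuous Q := by
    have h (a a' b b') := (differentiable_packingSum (boxDimers a a' b b')).continuous
    simp only [hQ, oddProd]
    fun_prop
  have hQne : ∀ z ∈ Metric.ball (0 : ℂ) (1 / 512), Q z ≠ 0 := by
    intro z hz
    have hne : ∀ a a' b b', packingSum (boxDimers a a' b b') (fun _ => z) ≠ 0 := by
      intro a a' b b'
      rw [packingSum_boxDimers, ← he _ _ z hz]
      exact Complex.exp_ne_zero _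
    simp only [hQ, oddProd]
    simp [hne]
  have hinv : (fun z => (Q z)⁻¹) =O[𝓝 0] fun _ => (1 : ℂ) :=
    (hQc.continuousAt.inv₀ (hQne 0 (mem_of_mem_nhds hball))).isBigO_one ℂ
  have hmul := (isBigO_evenProd_sub_oddProd i j).mul hinv
  simp only [mul_one] at hmul
  refine hmul.congr' ?_ EventuallyEq.rfl
  filter_upwards [hball] with z hz
  have := hQne z hz
  rw [exp_mixedDiff he i j hz]
  change (_ - Q z) * (Q z)⁻¹ = _ / Q z - 1
  field_simp

/-- The absolute values of the coefficients add up to (1 + 2 + 1)^2 = 16, and each logarithm is at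
most 2(i+1)(j+1). -/
theorem norm_mixedDiff_le_mul
    (hb : ∀ m n, ∀ z ∈ Metric.ball (0 : ℂ) (1 / 512), ‖l m n z‖ ≤ 2 * (m * n)) (i j : ℕ)
    {z : ℂ} (hz : z ∈ Metric.ball (0 : ℂ) (1 / 512)) :
    ‖mixedDiff (fun m n => l m n z) i j‖ ≤ 32 * ((i + 1) * (j + 1)) := by
  have hb' : ∀ m n, m ≤ i + 1 → n ≤ j + 1 → ‖l m n z‖ ≤ 2 * ((i + 1) * (j + 1)) := by
    intro m n hm hn
    refine (hb m n z hz).trans ?_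
    have hm' : (m : ℝ) ≤ i + 1 := by exact_mod_cast hm
    have hn' : (n : ℝ) ≤ j + 1 := by exact_mod_cast hn
    gcongr
  have hrow : ∀ n, n ≤ j + 1 →
      ‖l (i + 1) n z - 2 • l i n z + l (i - 1) n z‖ ≤ 8 * ((i + 1) * (j + 1)) := by
    intro n hn
    have h1 := hb' (i + 1) n le_rfl hn
    have h2 := hb' i n (by omega) hn
    have h3 := hb' (i - 1) n (by omega) hn
    have h4 : ‖2 • l i n z‖ ≤ 2 * ‖l i n z‖ := by simp
    linarith [norm_add_le (l (i + 1) n z - 2 • l i n z) (l (i - 1) n z),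
      norm_sub_le (l (i + 1) n z) (2 • l i n z)]
  unfold mixedDiff
  set A := l (i + 1) (j + 1) z - 2 • l i (j + 1) z + l (i - 1) (j + 1) z
  set B := l (i + 1) j z - 2 • l i j z + l (i - 1) j z
  set C := l (i + 1) (j - 1) z - 2 • l i (j - 1) z + l (i - 1) (j - 1) z
  have h1 : ‖A‖ ≤ _ := hrow (j + 1) le_rfl
  have h2 : ‖B‖ ≤ _ := hrow j (by omega)
  have h3 : ‖C‖ ≤ _ := hrow (j - 1) (by omega)
  have h4 : ‖2 • B‖ ≤ 2 * ‖B‖ := by simp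
  linarith [norm_add_le (A - 2 • B) C, norm_sub_le A (2 • B)]

/-- The exponential decay of the weights of the finite lattice expansion. -/
theorem norm_mixedDiff_le
    (hd : ∀ m n, DifferentiableOn ℂ (l m n) (Metric.ball 0 (1 / 512)))
    (h0 : ∀ m n, l m n 0 = 0)
    (he : ∀ m n, ∀ z ∈ Metric.ball (0 : ℂ) (1 / 512),
      Complex.exp (l m n z) = packingSum (dimers m n) (fun _ => z))
    (hb : ∀ m n, ∀ z ∈ Metric.ball (0 : ℂ) (1 / 512), ‖l m n z‖ ≤ 2 * (m * n)) (i j : ℕ)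
    {z : ℂ} (hz : z ∈ Metric.ball (0 : ℂ) (1 / 512)) :
    ‖mixedDiff (fun m n => l m n z) i j‖ ≤ 32 * ((i + 1) * (j + 1)) * (512 * ‖z‖) ^ (i + j) := by
  rcases Nat.eq_zero_or_pos (i + j) with hij | hij
  · rw [hij, pow_zero, mul_one]
    exact norm_mixedDiff_le_mul hb i j hz
  · obtain ⟨k, hk⟩ := Nat.exists_eq_add_of_lt hij
    have hw0 : mixedDiff (fun m n => l m n 0) i j = 0 := by simp [mixedDiff, h0]
    -- Higher-order Schwarz lemma: being o(z^k) with k + 1 = i + j yields the full power i + j.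
    have h := Complex.dist_le_mul_div_pow_of_mapsTo_ball_of_isLittleO (n := k)
      (R₂ := 32 * ((i + 1) * (j + 1))) (differentiableOn_mixedDiff hd i j)
      (fun z hz => by
        rw [hw0, mem_closedBall_zero_iff]
        exact norm_mixedDiff_le_mul hb i j hz) ?_ hz
    · rw [hw0, dist_zero_right, dist_zero_right] at h
      rw [hk, zero_add]
      convert h using 3
      ring
    · simp only [hw0, sub_zero]
      refine (isBigO_mixedDiff hd h0 he i j).trans_isLittleO ?_
      have : (fun z : ℂ => z ^ (i + j)) =o[𝓝 0] fun z => z ^ k :=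
        isLittleO_pow_pow (by omega)
      simpa using this.norm_right

end Weights


/-! ### Summation identities for finite differences -/

section Differences

variable {E : Type*} [AddCommGroup E]

/-- Discrete Taylor formula: the second differences are summed twice. At `i = 0` the truncated `f (0
- 1)` is `f 0 = 0`, the correct boundary value. -/
theorem eq_sum_secondDiff {f : ℕ → E} (h0 : f 0 = 0) (m : ℕ) :
    f m = ∑ i ∈ Finset.range m, (m - i) • (f (i + 1) - 2 • f i + f (i - 1)) := by
  have h1 : ∀ m, ∑ i ∈ Finset.range (m + 1), (f (i + 1) - 2 • f i + f (i - 1))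
      = f (m + 1) - f m := by
    intro m
    induction m with
    | zero => simp [h0]
    | succ m ih =>
      rw [Finset.sum_range_succ, ih, Nat.add_sub_cancel, two_nsmul]
      abel
  induction m with
  | zero => simp [h0]
  | succ m ih =>
    have h2 : ∀ i ∈ Finset.range (m + 1), (m + 1 - i) • (f (i + 1) - 2 • f i + f (i - 1))
        = (m - i) • (f (i + 1) - 2 • f i + f (i - 1)) + (f (i + 1) - 2 • f i + f (i - 1)) := by
      intro i hi
      rw [Nat.succ_sub (Nat.lt_succ_iff.1 (Finset.mem_range.1 hi)), succ_nsmul]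
    rw [Finset.sum_congr rfl h2, Finset.sum_add_distrib, h1, Finset.sum_range_succ, ← ih,
      Nat.sub_self, zero_nsmul]
    abel

theorem eq_sum_mixedDiff {f : ℕ → ℕ → E} (h0 : ∀ n, f 0 n = 0) (h0' : ∀ m, f m 0 = 0) (m n : ℕ) :
    f m n = ∑ i ∈ Finset.range m, ∑ j ∈ Finset.range n, (m - i) • (n - j) • mixedDiff f i j := by
  rw [eq_sum_secondDiff (f := fun m => f m n) (h0 n) m]
  refine Finset.sum_congr rfl fun i _ => ?_
  rw [← Finset.smul_sum]
  congr 1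
  exact eq_sum_secondDiff (f := fun n => f (i + 1) n - 2 • f i n + f (i - 1) n) (by simp [h0']) n

theorem sum_antidiagonal_succ_fst {h : ℕ → ℕ → E} (h0 : ∀ j, h 0 j = 0) (K : ℕ) :
    ∑ p ∈ Finset.HasAntidiagonal.antidiagonal K, h (p.1 + 1) p.2 =
      ∑ p ∈ Finset.HasAntidiagonal.antidiagonal (K + 1), h p.1 p.2 := by
  simp [Finset.Nat.antidiagonal_succ, h0]

theorem sum_antidiagonal_succ_snd {h : ℕ → ℕ → E} (h0 : ∀ j, h j 0 = 0) (K : ℕ) :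
    ∑ p ∈ Finset.HasAntidiagonal.antidiagonal K, h p.1 (p.2 + 1) =
      ∑ p ∈ Finset.HasAntidiagonal.antidiagonal (K + 1), h p.1 p.2 := by
  simp [Finset.Nat.antidiagonal_succ', h0]

theorem sum_antidiagonal_pred_fst {h : ℕ → ℕ → E} (h0 : ∀ j, h 0 j = 0) (K : ℕ) :
    ∑ p ∈ Finset.HasAntidiagonal.antidiagonal K, h (p.1 - 1) p.2 =
      ∑ p ∈ Finset.HasAntidiagonal.antidiagonal (K - 1), h p.1 p.2 := by
  cases K with
  | zero => simp
  | succ K => simp [Finset.Nat.antidiagonal_succ, h0]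

theorem sum_antidiagonal_pred_snd {h : ℕ → ℕ → E} (h0 : ∀ j, h j 0 = 0) (K : ℕ) :
    ∑ p ∈ Finset.HasAntidiagonal.antidiagonal K, h p.1 (p.2 - 1) =
      ∑ p ∈ Finset.HasAntidiagonal.antidiagonal (K - 1), h p.1 p.2 := by
  cases K with
  | zero => simp
  | succ K => simp [Finset.Nat.antidiagonal_succ', h0]

/-- On antidiagonals the mixed second difference becomes a fourth difference. -/
theorem sum_antidiagonal_mixedDiff {f : ℕ → ℕ → ℝ} (h0 : ∀ n, f 0 n = 0) (h0' : ∀ m, f m 0 = 0)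
    {T : ℕ → ℝ} (hT : ∀ K, T K = ∑ p ∈ Finset.HasAntidiagonal.antidiagonal K, f p.1 p.2) (K : ℕ) :
    ∑ p ∈ Finset.HasAntidiagonal.antidiagonal K, mixedDiff f p.1 p.2
      = T (K + 2) - 4 * T (K + 1) + 6 * T K - 4 * T (K - 1) + T (K - 2) := by
  have e1 : ∑ p ∈ Finset.HasAntidiagonal.antidiagonal K, f (p.1 + 1) (p.2 + 1) = T (K + 2) := by
    rw [sum_antidiagonal_succ_fst (h := fun i j => f i (j + 1)) (by simp [h0]),
      sum_antidiagonal_succ_snd h0', hT]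
  have e2 : ∑ p ∈ Finset.HasAntidiagonal.antidiagonal K, f p.1 (p.2 + 1) = T (K + 1) := by
    rw [sum_antidiagonal_succ_snd h0', hT]
  have e3 : ∑ p ∈ Finset.HasAntidiagonal.antidiagonal K, f (p.1 - 1) (p.2 + 1)
      = ∑ p ∈ Finset.HasAntidiagonal.antidiagonal (K - 1), f p.1 (p.2 + 1) :=
    sum_antidiagonal_pred_fst (h := fun i j => f i (j + 1)) (by simp [h0]) K
  have e4 : ∑ p ∈ Finset.HasAntidiagonal.antidiagonal K, f (p.1 + 1) p.2 = T (K + 1) := by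
    rw [sum_antidiagonal_succ_fst h0, hT]
  have e5 : ∑ p ∈ Finset.HasAntidiagonal.antidiagonal K, f (p.1 - 1) p.2 = T (K - 1) := by
    rw [sum_antidiagonal_pred_fst h0, hT]
  have e6 : ∑ p ∈ Finset.HasAntidiagonal.antidiagonal K, f (p.1 + 1) (p.2 - 1)
      = ∑ p ∈ Finset.HasAntidiagonal.antidiagonal (K - 1), f (p.1 + 1) p.2 :=
    sum_antidiagonal_pred_snd (h := fun i j => f (i + 1) j) (by simp [h0']) K
  have e7 : ∑ p ∈ Finset.HasAntidiagonal.antidiagonal K, f p.1 (p.2 - 1) = T (K - 1) := by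
    rw [sum_antidiagonal_pred_snd h0', hT]
  have e8 : ∑ p ∈ Finset.HasAntidiagonal.antidiagonal K, f (p.1 - 1) (p.2 - 1) = T (K - 2) := by
    rw [sum_antidiagonal_pred_fst (h := fun i j => f i (j - 1)) (by simp [h0]),
      sum_antidiagonal_pred_snd h0', hT, Nat.sub_sub]
  have e9 : ∑ p ∈ Finset.HasAntidiagonal.antidiagonal K, f (p.1 - 1) (p.2 + 1) = T K ∧
      ∑ p ∈ Finset.HasAntidiagonal.antidiagonal K, f (p.1 + 1) (p.2 - 1) = T K := by
    cases K with
    | zero =>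
      have := hT 0
      simp only [Finset.Nat.antidiagonal_zero, Finset.sum_singleton, h0] at this ⊢
      simp [this, h0']
    | succ K =>
      rw [e3, e6, Nat.add_sub_cancel, sum_antidiagonal_succ_snd h0', sum_antidiagonal_succ_fst h0,
        hT]
      exact ⟨rfl, rfl⟩
  simp only [mixedDiff, nsmul_eq_mul, Finset.sum_add_distrib, Finset.sum_sub_distrib,
    ← Finset.mul_sum, e1, e2, e9.1, e4, e5, e9.2, e7, e8, ← hT]
  push_cast
  ring

/-- Fourth differences telescope to a third difference. The truncated indices at small `K` are
harmless because `T 0` and `T 1` vanish. -/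
theorem thirdDiff_eq_sum_mixedDiff {f : ℕ → ℕ → ℝ} (h0 : ∀ n, f 0 n = 0) (h0' : ∀ m, f m 0 = 0)
    {T : ℕ → ℝ} (hT : ∀ K, T K = ∑ p ∈ Finset.HasAntidiagonal.antidiagonal K, f p.1 p.2) (N : ℕ) :
    T (N + 3) - 3 * T (N + 2) + 3 * T (N + 1) - T N
      = ∑ K ∈ Finset.range (N + 2), ∑ p ∈ Finset.HasAntidiagonal.antidiagonal K, mixedDiff f p.1 p.2 := by
  simp only [sum_antidiagonal_mixedDiff h0 h0' hT]
  induction N with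
  | zero =>
    have h1 : T 0 = 0 := by rw [hT]; simp [h0]
    have h2 : T 1 = 0 := by rw [hT]; simp [Finset.Nat.antidiagonal_succ, h0, h0']
    simp [Finset.sum_range_succ, h1, h2]
    ring
  | succ N ih =>
    rw [Finset.sum_range_succ, ← ih, show N + 2 - 1 = N + 1 by omega, show N + 2 - 2 = N by omega]
    ring

end Differences

/-! ### The limit at nonnegative activity -/

section Superadditive

/-- The two-dimensional Fekete lemma. -/
theorem exists_tendsto_of_superadditive {a : ℕ → ℕ → ℝ} (hnn : ∀ m n, 0 ≤ a m n)
    (h1 : ∀ m m' n, a m n + a m' n ≤ a (m + m') n) (h2 : ∀ m n n', a m n + a m n' ≤ a m (n + n'))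
    {C : ℝ} (hC : ∀ m n, a m n ≤ C * (m * n)) :
    ∃ L, Tendsto (fun p : ℕ × ℕ => a p.1 p.2 / ((p.1 : ℝ) * (p.2 : ℝ))) (atTop ×ˢ atTop) (𝓝 L) := by
  have k1 : ∀ k p r n, k * a p n ≤ a (p * k + r) n := by
    intro k p r n
    induction k with
    | zero => simpa using hnn r n
    | succ k ih =>
      have := h1 p (p * k + r) n
      rw [show p * (k + 1) + r = p + (p * k + r) by ring]
      push_cast
      linarith
  have k2 : ∀ k p r m, k * a m p ≤ a m (p * k + r) := by
    intro k p r m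
    induction k with
    | zero => simpa using hnn m r
    | succ k ih =>
      have := h2 m p (p * k + r)
      rw [show p * (k + 1) + r = p + (p * k + r) by ring]
      push_cast
      linarith
  -- An m × n rectangle holds this many disjoint p × q blocks; the leftover strips contribute
  -- nonnegatively.
  have k3 : ∀ p q m n : ℕ, ((m / p : ℕ) : ℝ) * ((n / q : ℕ) : ℝ) * a p q ≤ a m n := by
    intro p q m n
    have e1 := k1 (m / p) p (m % p) n
    have e2 := k2 (n / q) q (n % q) p
    rw [Nat.div_add_mod] at e1 e2
    have e3 := mul_le_mul_of_nonneg_left e2 (Nat.cast_nonneg (α := ℝ) (m / p))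
    linarith
  set s : Set ℝ := {x | ∃ m n : ℕ, 0 < m ∧ 0 < n ∧ x = a m n / ((m : ℝ) * (n : ℝ))} with hs
  have hbdd : BddAbove s := by
    refine ⟨C, ?_⟩
    rintro _ ⟨m, n, hm, hn, rfl⟩
    have hm' : (0 : ℝ) < m := by exact_mod_cast hm
    have hn' : (0 : ℝ) < n := by exact_mod_cast hn
    rw [div_le_iff₀ (by positivity)]
    exact hC m n
  have hne : s.Nonempty := ⟨_, 1, 1, one_pos, one_pos, rfl⟩
  have hpos : ∀ᶠ p : ℕ × ℕ in atTop ×ˢ atTop, 0 < p.1 ∧ 0 < p.2 :=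
    (eventually_gt_atTop 0).prod_mk (eventually_gt_atTop 0)
  refine ⟨sSup s, tendsto_order.2 ⟨fun b hb => ?_, fun b hb => ?_⟩⟩
  · obtain ⟨_, ⟨p, q, hp, hq, rfl⟩, hlt⟩ := exists_lt_of_lt_csSup hne hb
    have hdiv : ∀ p : ℕ, Tendsto (fun m : ℕ => ((m / p : ℕ) : ℝ) / m) atTop (𝓝 ((p : ℝ)⁻¹)) := by
      intro p
      have := (tendsto_nat_floor_mul_div_atTop (R := ℝ) (a := (p : ℝ)⁻¹) (by positivity)).comp
        tendsto_natCast_atTop_atTop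
      refine this.congr fun m => ?_
      rw [Function.comp_apply, ← Nat.floor_div_eq_div (K := ℝ) m p, inv_mul_eq_div]
    have hlim : Tendsto (fun r : ℕ × ℕ => ((r.1 / p : ℕ) : ℝ) / r.1 *
        (((r.2 / q : ℕ) : ℝ) / r.2) * a p q) (atTop ×ˢ atTop)
        (𝓝 ((p : ℝ)⁻¹ * (q : ℝ)⁻¹ * a p q)) :=
      (((hdiv p).comp tendsto_fst).mul ((hdiv q).comp tendsto_snd)).mul_const _
    have hlt' : b < (p : ℝ)⁻¹ * (q : ℝ)⁻¹ * a p q := by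
      rwa [← mul_inv, inv_mul_eq_div]
    filter_upwards [hlim.eventually_const_lt hlt', hpos] with r hr hr0
    refine hr.trans_le ?_
    have hm' : (0 : ℝ) < r.1 := by exact_mod_cast hr0.1
    have hn' : (0 : ℝ) < r.2 := by exact_mod_cast hr0.2
    rw [div_mul_div_comm, div_mul_eq_mul_div]
    exact div_le_div_of_nonneg_right (k3 p q r.1 r.2) (by positivity)
  · filter_upwards [hpos] with r hr
    exact (le_csSup hbdd ⟨r.1, r.2, hr.1, hr.2, rfl⟩).trans_lt hb

/-- Forbidding the dimers that cross the cut only drops nonnegative terms. -/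
theorem packingSum_dimers_superadditive {z : ℝ} (hz : 0 ≤ z) (m m' n : ℕ) :
    packingSum (dimers m n) (fun _ => z) * packingSum (dimers m' n) (fun _ => z)
      ≤ packingSum (dimers (m + m') n) (fun _ => z) := by
  have e := packingSum_boxDimers m (m + m') 0 n z
  rw [Nat.add_sub_cancel_left, Nat.sub_zero] at e
  have hdis := disjoint_boxDimers_of_fst (a := 0) (a' := m) (b := 0) (b' := n) (u := m)
    (u' := m + m') (v := 0) (v' := n) le_rfl
  rw [← e, dimers_eq_boxDimers, dimers_eq_boxDimers,
    ← packingSum_union (disjoint_of_pairwise_disjoint isDimer_of_mem_boxDimers hdis) hdis]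
  refine packingSum_mono (Finset.union_subset ?_ ?_) hz
  · refine Finset.filter_subset_filter _ (Finset.powerset_mono.2 (Finset.product_subset_product_left
      (Finset.Ico_subset_Ico le_rfl (Nat.le_add_right _ _))))
  · refine Finset.filter_subset_filter _ (Finset.powerset_mono.2 (Finset.product_subset_product_left
      (Finset.Ico_subset_Ico (Nat.zero_le _) le_rfl)))

theorem exists_tendsto_log_of_nonneg {z : ℝ} (hz : 0 ≤ z) :
    ∃ L, Tendsto (fun p : ℕ × ℕ => Real.log (partitionFn p.1 p.2 z) / ((p.1 : ℝ) * (p.2 : ℝ)))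
      (atTop ×ˢ atTop) (𝓝 L) := by
  have hone : ∀ m n, 1 ≤ partitionFn m n z := fun m n => by
    rw [partitionFn_eq_packingSum]
    exact one_le_packingSum _ hz
  have hpos : ∀ m n, 0 < partitionFn m n z := fun m n => one_pos.trans_le (hone m n)
  have hswap : ∀ m n, partitionFn m n z = partitionFn n m z := fun m n => by
    rw [partitionFn_eq_packingSum, partitionFn_eq_packingSum, packingSum_dimers_swap]
  have hsup : ∀ m m' n, Real.log (partitionFn m n z) + Real.log (partitionFn m' n z)
      ≤ Real.log (partitionFn (m + m') n z) := by
    intro m m' n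
    rw [← Real.log_mul (hpos _ _).ne' (hpos _ _).ne']
    refine Real.log_le_log (mul_pos (hpos _ _) (hpos _ _)) ?_
    simp only [partitionFn_eq_packingSum]
    exact packingSum_dimers_superadditive hz m m' n
  refine exists_tendsto_of_superadditive (a := fun m n => Real.log (partitionFn m n z))
    (C := 2 * Real.log (1 + z)) (fun m n => Real.log_nonneg (hone m n)) hsup ?_ ?_
  · intro m n n'
    simp only [hswap m]
    exact hsup n n' m
  · intro m n
    have h1 : partitionFn m n z ≤ (1 + z) ^ (2 * (m * n)) := by
      rw [partitionFn_eq_packingSum]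
      exact (packingSum_le _ hz).trans (pow_le_pow_right₀ (by linarith) (card_dimers_le m n))
    have h2 := Real.log_le_log (hpos m n) h1
    rw [Real.log_pow] at h2
    push_cast at h2
    linarith

end Superadditive


/-! ### The box expansion of the free energy -/

theorem summable_weight_bound :
    Summable fun p : ℕ × ℕ => 32 * (((p.1 : ℝ) + 1) * (p.2 + 1)) * (1 / 2) ^ (p.1 + p.2) := by
  have h1 : Summable fun i : ℕ => ((i : ℝ) + 1) * (1 / 2) ^ i := by
    have h := summable_pow_mul_geometric_of_norm_lt_one (R := ℝ) 1 (r := 1 / 2) (by norm_num)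
    have h' := summable_geometric_of_lt_one (r := (1 / 2 : ℝ)) (by norm_num) (by norm_num)
    refine (h.add h').congr fun i => ?_
    ring
  have h2 := (h1.mul_of_nonneg h1 (fun i => by positivity) (fun i => by positivity)).mul_left 32
  refine h2.congr fun p => ?_
  rw [pow_add]
  ring

/-- The weights of the finite lattice expansion at real activity `x`. -/
noncomputable def weight (x : ℝ) (p : ℕ × ℕ) : ℝ :=
  mixedDiff (fun m n => Real.log (partitionFn m n x)) p.1 p.2

/-- On half the zero-free radius, 512|z| < 1/2, so the weights have a summable majorant independent
of z and their sum is holomorphic. -/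
theorem exists_pressure : ∃ G : ℂ → ℂ, DifferentiableOn ℂ G (Metric.ball 0 (1 / 1024)) ∧
    ∀ x : ℝ, |x| < 1 / 1024 → HasSum (weight x) (G x).re ∧
      ∀ p, |weight x p| ≤ 32 * (((p.1 : ℝ) + 1) * (p.2 + 1)) * (512 * |x|) ^ (p.1 + p.2) := by
  obtain ⟨l, hl⟩ := exists_log_dimers
  have hd := fun m n => (hl m n).1
  have h0 := fun m n => (hl m n).2.1
  have he := fun m n z hz => ((hl m n).2.2 z hz).1
  have hb := fun m n z hz => ((hl m n).2.2 z hz).2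
  have hsub : Metric.ball (0 : ℂ) (1 / 1024) ⊆ Metric.ball 0 (1 / 512) :=
    Metric.ball_subset_ball (by norm_num)
  have hle : ∀ (p : ℕ × ℕ) (z : ℂ), z ∈ Metric.ball (0 : ℂ) (1 / 1024) →
      ‖mixedDiff (fun m n => l m n z) p.1 p.2‖
        ≤ 32 * (((p.1 : ℝ) + 1) * (p.2 + 1)) * (1 / 2) ^ (p.1 + p.2) := by
    intro p z hz
    refine (norm_mixedDiff_le hd h0 he hb p.1 p.2 (hsub hz)).trans ?_
    rw [mem_ball_zero_iff] at hz
    gcongr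
    linarith
  refine ⟨fun z => ∑' p : ℕ × ℕ, mixedDiff (fun m n => l m n z) p.1 p.2,
    Complex.differentiableOn_tsum_of_summable_norm summable_weight_bound
      (fun p => (differentiableOn_mixedDiff hd p.1 p.2).mono hsub) Metric.isOpen_ball hle, ?_⟩
  intro x hx
  have hxm : (x : ℂ) ∈ Metric.ball (0 : ℂ) (1 / 1024) := by simpa using hx
  have hlog : ∀ m n, Real.log (partitionFn m n x) = (l m n x).re := by
    intro m n
    have h1 : Complex.exp (l m n x) = ((partitionFn m n x : ℝ) : ℂ) := by
      rw [he m n x (hsub hxm), partitionFn_eq_packingSum]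
      exact (map_packingSum Complex.ofRealHom _ _).symm
    have h2 := congrArg norm h1
    rw [Complex.norm_exp, Complex.norm_real, Real.norm_eq_abs] at h2
    -- The modulus of exp l is exp (Re l), so the real logarithm is Re l whichever branch `l` is.
    rw [← Real.log_abs, ← h2, Real.log_exp]
  have hw : ∀ p, weight x p = (mixedDiff (fun m n => l m n x) p.1 p.2).re := by
    intro p
    simp [weight, mixedDiff, hlog]
  refine ⟨?_, fun p => ?_⟩
  · have hs : Summable fun p : ℕ × ℕ => mixedDiff (fun m n => l m n x) p.1 p.2 :=
      Summable.of_norm_bounded summable_weight_bound fun p => hle p x hxm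
    simpa only [← hw] using Complex.hasSum_re hs.hasSum
  · rw [hw]
    refine (Complex.abs_re_le_norm _).trans ?_
    simpa using norm_mixedDiff_le hd h0 he hb p.1 p.2 (hsub hxm)

theorem log_partitionFn_zero_left (x : ℝ) (n : ℕ) : Real.log (partitionFn 0 n x) = 0 := by
  rw [partitionFn_eq_packingSum, dimers_zero_left, packingSum_empty, Real.log_one]

theorem log_partitionFn_zero_right (x : ℝ) (n : ℕ) : Real.log (partitionFn n 0 x) = 0 := by
  rw [partitionFn_eq_packingSum, dimers_zero_right, packingSum_empty, Real.log_one]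

theorem logSum_eq (N : ℕ) (x : ℝ) : logSum N x =
    ∑ p ∈ Finset.HasAntidiagonal.antidiagonal N, Real.log (partitionFn p.1 p.2 x) := by
  refine Finset.sum_filter_of_ne fun p _ hp => ?_
  by_contra h
  rw [not_and_or, not_lt, not_lt, Nat.le_zero, Nat.le_zero] at h
  rcases h with h | h
  · exact hp (by rw [h, log_partitionFn_zero_left])
  · exact hp (by rw [h, log_partitionFn_zero_right])

/-- The third difference of the logarithmic sums is a partial sum of the weights. -/
theorem logSum_thirdDiff (N : ℕ) (x : ℝ) :
    logSum (N + 3) x - 3 * logSum (N + 2) x + 3 * logSum (N + 1) x - logSum N x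
      = ∑ p ∈ (Finset.range (N + 2)).biUnion Finset.HasAntidiagonal.antidiagonal, weight x p := by
  rw [Finset.sum_biUnion]
  · exact thirdDiff_eq_sum_mixedDiff (f := fun m n => Real.log (partitionFn m n x))
      (T := fun K => logSum K x) (log_partitionFn_zero_left x) (log_partitionFn_zero_right x)
      (fun K => logSum_eq K x) N
  · intro K _ K' _ hK
    rw [Function.onFun, Finset.disjoint_left]
    intro p hp hp'
    rw [Finset.HasAntidiagonal.mem_antidiagonal] at hp hp'
    exact hK (hp.symm.trans hp')

theorem tendsto_natSub_div (i : ℕ) :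
    Tendsto (fun m : ℕ => ((m - i : ℕ) : ℝ) / m) atTop (𝓝 1) := by
  have h1 : Tendsto (fun m : ℕ => 1 - (i : ℝ) / m) atTop (𝓝 1) := by
    simpa using (tendsto_const_div_atTop_nhds_zero_nat (i : ℝ)).const_sub 1
  refine h1.congr' ?_
  filter_upwards [eventually_ge_atTop (i + 1)] with m hm
  have hm' : (m : ℝ) ≠ 0 := by
    have : 0 < m := by omega
    positivity
  rw [Nat.cast_sub (by omega), sub_div, div_self hm']

theorem natSub_div_le_one (i m : ℕ) : ((m - i : ℕ) : ℝ) / m ≤ 1 :=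
  div_le_one_of_le₀ (by exact_mod_cast Nat.sub_le m i) (Nat.cast_nonneg m)

/-- Truncated subtraction makes the coefficients vanish outside the rectangle, so the index set no
longer depends on m and n and dominated convergence applies. -/
theorem log_partitionFn_div_eq_tsum (x : ℝ) (m n : ℕ) :
    Real.log (partitionFn m n x) / ((m : ℝ) * n)
      = ∑' p : ℕ × ℕ, ((m - p.1 : ℕ) : ℝ) / m * (((n - p.2 : ℕ) : ℝ) / n) * weight x p := by
  rw [tsum_eq_sum (s := Finset.range m ×ˢ Finset.range n), Finset.sum_product,
    eq_sum_mixedDiff (f := fun m n => Real.log (partitionFn m n x))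
      (log_partitionFn_zero_left x) (log_partitionFn_zero_right x) m n, Finset.sum_div]
  · refine Finset.sum_congr rfl fun i _ => ?_
    rw [Finset.sum_div]
    refine Finset.sum_congr rfl fun j _ => ?_
    rw [nsmul_eq_mul, nsmul_eq_mul, weight, div_mul_div_comm, div_mul_eq_mul_div, mul_assoc]
  · rintro ⟨i, j⟩ h
    simp only [Finset.mem_product, Finset.mem_range, not_and_or, not_lt] at h
    rcases h with h | h <;> simp [Nat.sub_eq_zero_of_le h]

theorem tendsto_log_partitionFn_div {x : ℝ} (hs : Summable fun p => |weight x p|) :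
    Tendsto (fun r : ℕ × ℕ => Real.log (partitionFn r.1 r.2 x) / ((r.1 : ℝ) * (r.2 : ℝ)))
      (atTop ×ˢ atTop) (𝓝 (∑' p, weight x p)) := by
  simp only [log_partitionFn_div_eq_tsum]
  refine tendsto_tsum_of_dominated_convergence hs (fun p => ?_) (Eventually.of_forall fun r p => ?_)
  · have := (((tendsto_natSub_div p.1).comp (tendsto_fst (g := (atTop : Filter ℕ)))).mul
      ((tendsto_natSub_div p.2).comp (tendsto_snd (f := (atTop : Filter ℕ))))).mul_const (weight x p)
    simpa using this
  · rw [norm_mul, norm_mul, Real.norm_eq_abs, Real.norm_eq_abs, Real.norm_eq_abs,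
      abs_of_nonneg (by positivity), abs_of_nonneg (by positivity)]
    refine mul_le_of_le_one_left (abs_nonneg _) ?_
    exact mul_le_one₀ (natSub_div_le_one _ _) (by positivity) (natSub_div_le_one _ _)

/-- Convergence of the free energy per cell determines the thermodynamic limit. -/
theorem thermoLimit_of_tendsto {z L : ℝ}
    (hpos : ∀ m n : ℕ, 0 < m → 0 < n → 0 < partitionFn m n z)
    (h : Tendsto (fun p : ℕ × ℕ => Real.log (partitionFn p.1 p.2 z) / ((p.1 : ℝ) * (p.2 : ℝ)))
      (atTop ×ˢ atTop) (𝓝 L)) :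
    Tendsto (fun p : ℕ × ℕ => partitionFn p.1 p.2 z ^ (1 / ((p.1 : ℝ) * (p.2 : ℝ))))
        (atTop ×ˢ atTop) (𝓝 (Real.exp L)) ∧ thermoLimit z = Real.exp L := by
  have h1 : Tendsto (fun p : ℕ × ℕ => partitionFn p.1 p.2 z ^ (1 / ((p.1 : ℝ) * (p.2 : ℝ))))
      (atTop ×ˢ atTop) (𝓝 (Real.exp L)) := by
    refine ((Real.continuous_exp.tendsto L).comp h).congr' ?_
    filter_upwards [(eventually_gt_atTop 0).prod_mk (eventually_gt_atTop 0)] with p hp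
    rw [Function.comp_apply, Real.rpow_def_of_pos (hpos _ _ hp.1 hp.2), mul_one_div]
  exact ⟨h1, h1.limUnder_eq⟩

theorem partitionFn_pos {z : ℝ} (hz : -(1 / 1024) < z) (m n : ℕ) : 0 < partitionFn m n z := by
  rw [partitionFn_eq_packingSum]
  rcases le_or_gt 0 z with h | h
  · exact one_pos.trans_le (one_le_packingSum _ h)
  · refine packingSum_pos card_filter_not_disjoint_le ?_ _ isDimer_of_mem_dimers
    rw [abs_of_neg h]
    linarith

theorem abs_sub_sum_weight_le {x s : ℝ} (hx : |x| < 1 / 1024) (hs : HasSum (weight x) s)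
    (hw : ∀ p, |weight x p| ≤ 32 * (((p.1 : ℝ) + 1) * (p.2 + 1)) * (512 * |x|) ^ (p.1 + p.2))
    (K : ℕ) :
    |s - ∑ p ∈ (Finset.range K).biUnion Finset.HasAntidiagonal.antidiagonal, weight x p|
      ≤ (∑' p : ℕ × ℕ, 32 * (((p.1 : ℝ) + 1) * (p.2 + 1)) * (1 / 2) ^ (p.1 + p.2)) * 1024 ^ K
        * |x| ^ K := by
  set t := (Finset.range K).biUnion Finset.HasAntidiagonal.antidiagonal with ht
  have hsum : s - ∑ p ∈ t, weight x p = ∑' p : {p // p ∉ t}, weight x p := by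
    rw [← hs.tsum_eq, ← hs.summable.sum_add_tsum_subtype_compl t, add_sub_cancel_left]
  have hu := (summable_weight_bound.mul_right (1024 ^ K)).mul_right (|x| ^ K)
  rw [hsum, ← Real.norm_eq_abs, ← tsum_mul_right, ← tsum_mul_right]
  refine (tsum_of_norm_bounded (hu.subtype {p | p ∉ t}).hasSum ?_).trans
    (hu.tsum_subtype_le _ _ fun p => by positivity)
  rintro ⟨p, hp⟩
  have hK : K ≤ p.1 + p.2 := by
    by_contra! h
    exact hp (Finset.mem_biUnion.2 ⟨p.1 + p.2, Finset.mem_range.2 h, by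
      rw [Finset.HasAntidiagonal.mem_antidiagonal]⟩)
  obtain ⟨d, hd⟩ := Nat.exists_eq_add_of_le hK
  refine (hw p).trans ?_
  simp only [Function.comp_apply]
  -- Outside the partial sum i + j ≥ K: K factors supply |x|^K, and the others, each at most 1/2,
  -- keep the series summable.
  have h1 : (512 * |x|) ^ (p.1 + p.2) ≤ (1 / 2) ^ (p.1 + p.2) * 1024 ^ K * |x| ^ K := by
    have h2 : (512 * |x|) ^ d ≤ (1 / 2) ^ d :=
      pow_le_pow_left₀ (by positivity) (by linarith) d
    calc (512 * |x|) ^ (p.1 + p.2) = (512 * |x|) ^ K * (512 * |x|) ^ d := by rw [hd, pow_add]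
      _ ≤ (512 * |x|) ^ K * (1 / 2) ^ d := by gcongr
      _ = (1 / 2) ^ K * (1 / 2) ^ d * 1024 ^ K * |x| ^ K := by
        rw [show 512 * |x| = 1 / 2 * 1024 * |x| by ring, mul_pow, mul_pow]
        ring
      _ = _ := by rw [hd, pow_add]
  have h3 := mul_le_mul_of_nonneg_left h1
    (show (0 : ℝ) ≤ 32 * (((p.1 : ℝ) + 1) * (p.2 + 1)) by positivity)
  linarith

end MonomerDimer

theorem theorem1 :
    -- the thermodynamic limit exists, with all logarithms taken of positive numbers
    (∃ r : ℝ, 0 < r ∧ ∀ z : ℝ, -r < z →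
      (∀ m n : ℕ, 0 < m → 0 < n → 0 < MonomerDimer.partitionFn m n z) ∧
      0 < MonomerDimer.thermoLimit z ∧
      Tendsto (fun p : ℕ × ℕ =>
          MonomerDimer.partitionFn p.1 p.2 z ^ (1 / ((p.1 : ℝ) * (p.2 : ℝ))))
        (atTop ×ˢ atTop) (𝓝 (MonomerDimer.thermoLimit z)) ∧
      Tendsto (fun p : ℕ × ℕ =>
          Real.log (MonomerDimer.partitionFn p.1 p.2 z) / ((p.1 : ℝ) * (p.2 : ℝ)))
        (atTop ×ˢ atTop) (𝓝 (Real.log (MonomerDimer.thermoLimit z)))) ∧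
    -- its logarithm has a convergent power series at the origin
    AnalyticAt ℝ (fun z : ℝ => Real.log (MonomerDimer.thermoLimit z)) 0 ∧
    -- and the third difference of the sums `S_M` gives that series up to order `N - 2`
    ∀ N : ℕ, 4 ≤ N →
      (fun z : ℝ => Real.log (MonomerDimer.thermoLimit z) -
        (MonomerDimer.logSum N z - 3 * MonomerDimer.logSum (N - 1) z
          + 3 * MonomerDimer.logSum (N - 2) z - MonomerDimer.logSum (N - 3) z))
      =O[𝓝 0] fun z : ℝ => z ^ (N - 1) := by
  obtain ⟨G, hG, hsmall⟩ := MonomerDimer.exists_pressure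
  have htend : ∀ x : ℝ, |x| < 1 / 1024 → Tendsto (fun p : ℕ × ℕ =>
      Real.log (MonomerDimer.partitionFn p.1 p.2 x) / ((p.1 : ℝ) * (p.2 : ℝ)))
        (atTop ×ˢ atTop) (𝓝 (G x).re) := by
    intro x hx
    rw [← (hsmall x hx).1.tsum_eq]
    exact MonomerDimer.tendsto_log_partitionFn_div (hsmall x hx).1.summable.abs
  have hlog : ∀ x : ℝ, |x| < 1 / 1024 → Real.log (MonomerDimer.thermoLimit x) = (G x).re := by
    intro x hx
    rw [(MonomerDimer.thermoLimit_of_tendsto (fun m n _ _ =>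
      MonomerDimer.partitionFn_pos (neg_lt_of_abs_lt hx) m n) (htend x hx)).2, Real.log_exp]
  have hnhds : ∀ᶠ x : ℝ in 𝓝 0, |x| < 1 / 1024 := by
    filter_upwards [Metric.ball_mem_nhds (0 : ℝ) (by norm_num : (0 : ℝ) < 1 / 1024)] with x hx
    simpa using hx
  refine ⟨⟨1 / 1024, by norm_num, fun z hz => ?_⟩, ?_, fun N hN => ?_⟩
  · have hpos : ∀ m n : ℕ, 0 < m → 0 < n → 0 < MonomerDimer.partitionFn m n z :=
      fun m n _ _ => MonomerDimer.partitionFn_pos hz m n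
    obtain ⟨L, hL⟩ : ∃ L, Tendsto (fun p : ℕ × ℕ =>
        Real.log (MonomerDimer.partitionFn p.1 p.2 z) / ((p.1 : ℝ) * (p.2 : ℝ)))
        (atTop ×ˢ atTop) (𝓝 L) := by
      rcases le_or_gt 0 z with h | h
      · exact MonomerDimer.exists_tendsto_log_of_nonneg h
      · exact ⟨_, htend z (by rw [abs_of_neg h]; linarith)⟩
    obtain ⟨h1, h2⟩ := MonomerDimer.thermoLimit_of_tendsto hpos hL
    rw [h2, Real.log_exp]
    exact ⟨hpos, Real.exp_pos L, h1, hL⟩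
  · have h1 : AnalyticAt ℂ G ((0 : ℝ) : ℂ) :=
      hG.analyticAt (Metric.ball_mem_nhds _ (by norm_num))
    refine (h1.re_ofReal).congr ?_
    filter_upwards [hnhds] with x hx
    exact (hlog x hx).symm
  · obtain ⟨M, rfl⟩ := Nat.exists_eq_add_of_le' (show 3 ≤ N by omega)
    refine IsBigO.of_bound ((∑' p : ℕ × ℕ,
      32 * (((p.1 : ℝ) + 1) * (p.2 + 1)) * (1 / 2) ^ (p.1 + p.2)) * 1024 ^ (M + 2)) ?_
    filter_upwards [hnhds] with x hx
    rw [hlog x hx, show M + 3 - 1 = M + 2 by omega, show M + 3 - 2 = M + 1 by omega,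
      Nat.add_sub_cancel, MonomerDimer.logSum_thirdDiff, norm_pow, Real.norm_eq_abs,
      Real.norm_eq_abs]
    exact MonomerDimer.abs_sub_sum_weight_le hx (hsmall x hx).1 (hsmall x hx).2 (M + 2)
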